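/- All graphs are finite. (Loops and parallel edges are allowed a priori, but a graph of girth at least five has neither.) A circuit has no repeated vertices; the girth of a graph is the length of its shortest circuit ($\infty$ if there is none); a graph is cubic if every vertex has degree three; a pentagon of $G$ is a subgraph of $G$ that is a circuit of length five. In a drawing of a graph in the plane, vertices are distinct points, each edge is a polygonal arc (a simple arc made of finitely many straight line segments) joining its ends and containing no other vertex, and two edges meet only in common ends; the faces are the connected components of the complement of the drawing. A graph $G$ is doublecross if it has four edges $e_1,e_2,e_3,e_4$, where $e_i$ has ends $u_i$ and $v_i$ for $i=1,2,3,4$, such that the graph $G\setminus\{e_1,e_2,e_3,e_4\}$ can be drawn in the plane with the unbounded face bounded by a circuit $C$ (that is, the boundary of the unbounded face is the point set of $C$), on which $u_1,u_2,v_1,v_2,u_3,u_4,v_3,v_4$ are pairwise distinct and occur in the order listed. Theorem. Every cubic doublecross graph of girth at least five has at least six pentagons. -/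

import Mathlib

namespace Doublecross

/-- The plane. Only its topology, its affine structure and its bounded sets are used below. -/
abbrev Plane : Type := ℝ × ℝ

/-- `A` is a polygonal arc with ends `x` and `y`: it is the union of `n ≥ 1` nondegenerate straight
line segments `[p 0, p 1], [p 1, p 2], …, [p (n - 1), p n]`, where `p 0 = x` and `p n = y`, such
that two of these segments meet only if they are consecutive, and then only in their common end. -/
def IsPolygonalArc (x y : Plane) (A : Set Plane) : Prop :=
  ∃ (n : ℕ) (p : Fin (n + 1) → Plane),
    0 < n ∧ p 0 = x ∧ p (Fin.last n) = y ∧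
    (∀ i : Fin n, p i.castSucc ≠ p i.succ) ∧
    (∀ i j : Fin n, i < j →
      ∀ z ∈ segment ℝ (p i.castSucc) (p i.succ), z ∈ segment ℝ (p j.castSucc) (p j.succ) →
        i.succ = j.castSucc ∧ z = p i.succ) ∧
    A = ⋃ i : Fin n, segment ℝ (p i.castSucc) (p i.succ)

/-- A drawing of the graph `H` in the plane (without crossings): distinct vertices are distinct
points, every edge is a polygonal arc joining its two ends, an edge contains no vertex other than
its ends, and two edges meet only in common ends. (The value of `arc` at a pair that is not an
edge of `H` plays no role.) -/
structure PlaneDrawing {V : Type*} (H : SimpleGraph V) where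
  pos : V → Plane
  arc : Sym2 V → Set Plane
  pos_injective : Function.Injective pos
  isPolygonalArc : ∀ a b : V, H.Adj a b → IsPolygonalArc (pos a) (pos b) (arc s(a, b))
  mem_of_pos_mem : ∀ e ∈ H.edgeSet, ∀ w : V, pos w ∈ arc e → w ∈ e
  arc_inter : ∀ e ∈ H.edgeSet, ∀ f ∈ H.edgeSet, e ≠ f →
    ∀ z ∈ arc e, z ∈ arc f → ∃ w : V, w ∈ e ∧ w ∈ f ∧ z = pos w

namespace PlaneDrawing

variable {V : Type*} {H : SimpleGraph V}

/-- The set of points of the plane occupied by the drawing. -/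
def carrier (D : PlaneDrawing H) : Set Plane :=
  Set.range D.pos ∪ ⋃ e ∈ H.edgeSet, D.arc e

/-- The faces of a drawing: the connected components of its complement in the plane. -/
def IsFace (D : PlaneDrawing H) (F : Set Plane) : Prop :=
  ∃ x ∈ D.carrierᶜ, F = connectedComponentIn D.carrierᶜ x

/-- The unbounded face of the drawing is bounded by the circuit that the closed walk `C` traverses:
its boundary is the union of the edges of `C`. -/
def OuterFaceBoundedBy (D : PlaneDrawing H) {a : V} (C : H.Walk a a) : Prop :=
  ∃ F : Set Plane, D.IsFace F ∧ ¬ Bornology.IsBounded F ∧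
    frontier F = ⋃ e ∈ {e | e ∈ C.edges}, D.arc e

end PlaneDrawing

/-- `G` is doublecross: it has four edges `e i = u i v i` (`i = 0, 1, 2, 3`) such that `G` with
these edges deleted can be drawn in the plane with the unbounded face bounded by a circuit `C`, on
which `u 0, u 1, v 0, v 1, u 2, u 3, v 2, v 3` are pairwise distinct and occur in the order listed.
The circuit is traversed starting from `u 0`. -/
def IsDoublecross {V : Type*} (G : SimpleGraph V) : Prop :=
  ∃ u v : Fin 4 → V,
    (∀ i, G.Adj (u i) (v i)) ∧
    [u 0, u 1, v 0, v 1, u 2, u 3, v 2, v 3].Nodup ∧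
    ∃ (D : PlaneDrawing (G.deleteEdges (Set.range fun i => s(u i, v i))))
      (C : (G.deleteEdges (Set.range fun i => s(u i, v i))).Walk (u 0) (u 0)),
      C.IsCycle ∧ D.OuterFaceBoundedBy C ∧
      [u 0, u 1, v 0, v 1, u 2, u 3, v 2, v 3].Sublist C.support

/-- A pentagon of `G`: a subgraph that is a circuit of length five. -/
def IsPentagon {V : Type*} (G : SimpleGraph V) (P : G.Subgraph) : Prop :=
  ∃ (a : V) (c : G.Walk a a), c.IsCycle ∧ c.length = 5 ∧ P = c.toSubgraph

end Doublecross

/-! Delete the four edges and let `H` be the remaining graph, with `E` edges and `V` vertices, drawn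
with outer circuit `C`. Cubicity gives `2E + 8 = 3V`. Euler's inequality supplies at least `E - V +
1` faces besides the outer one. Each has a nonempty boundary without vertices of degree one, hence
with at least five edges, and with exactly five only if it is a pentagon. Every edge lies on at most
two such boundaries, an edge of `C` on at most one. If `p` of the boundaries are pentagons, then
`6(E - V + 1) ≤ 2E - |C| + p`, that is, `p ≥ |C| - 10` (`exists_pentagons_of_drawing`).

A crossing pair of deleted edges with ends at positions `a < b < c < d` on `C` closes up three
circuits: one through each edge, one through both. As each has length at least five, `d - a ≥ 6`,
and if `d - a = 6` then one of them is a pentagon. So the pair contributes at least `7 - (d - a)`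
pentagons (`crossing_pair_count`). The two pairs occupy disjoint stretches of `C`, so `|C|` is at
least the sum of the two values `d - a`, plus 2, and everything adds up to `16 - 10 = 6`. Pentagons
found in different ways are distinct because they contain different sets of deleted edges
(`six_le_ncard_pentagons`).

The planar input, `PlaneDrawing.exists_boundaries`, is proved without the Jordan curve theorem. For
the number of faces, a real cycle of `H` is sent to its winding numbers on the faces, measured
relative to the outer face. These jump by the weight across each edge, so the map is injective, and
the cycle space has dimension at least `E - V + 1`. For the boundaries, a union of faces cannot jump
across exactly one of the segments at a node, since a disc slit along one radius is connected. If it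
jumps nowhere, it is empty or the whole complement, since the plane minus finitely many points is
connected. -/

namespace Doublecross

open Filter Topology Set

/-! ### Half-planes and segments in coordinates. -/

/-- Twice the signed area of the triangle `p q z`; it is positive to the left of the line `p q`. -/
def side (p q z : Plane) : ℝ := (q.1 - p.1) * (z.2 - p.2) - (q.2 - p.2) * (z.1 - p.1)

/-- The inner product of `q - p` and `z - p`. -/
def along (p q z : Plane) : ℝ := (q.1 - p.1) * (z.1 - p.1) + (q.2 - p.2) * (z.2 - p.2)

theorem continuous_along (p q : Plane) : Continuous (along p q) := by
  unfold along; fun_prop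

theorem along_self_pos {p q : Plane} (h : p ≠ q) : 0 < along p q q := by
  unfold along
  have h' : q.1 - p.1 ≠ 0 ∨ q.2 - p.2 ≠ 0 := by
    by_contra! hc
    exact h (Prod.ext (by linarith [hc.1]) (by linarith [hc.2]))
  rcases h' with h' | h' <;> have := mul_self_pos.2 h'
  · nlinarith [mul_self_nonneg (q.2 - p.2)]
  · nlinarith [mul_self_nonneg (q.1 - p.1)]

/-- The two inequalities are open conditions, so near an interior point the segment is cut out by
`side p q z = 0` alone. -/
theorem mem_openSegment_iff_side_along {p q z : Plane} (h : p ≠ q) :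
    z ∈ openSegment ℝ p q ↔ side p q z = 0 ∧ 0 < along p q z ∧ along p q z < along p q q := by
  have hpos := along_self_pos h
  constructor
  · rw [openSegment_eq_image']
    rintro ⟨t, ⟨ht0, ht1⟩, rfl⟩
    have e1 : along p q (p + t • (q - p)) = t * along p q q := by
      simp only [along, Prod.fst_add, Prod.snd_add, Prod.smul_fst, Prod.smul_snd, Prod.fst_sub,
        Prod.snd_sub, smul_eq_mul]; ring
    refine ⟨?_, ?_, ?_⟩
    · simp only [side, Prod.fst_add, Prod.snd_add, Prod.smul_fst, Prod.smul_snd, Prod.fst_sub,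
        Prod.snd_sub, smul_eq_mul]; ring
    · rw [e1]; positivity
    · rw [e1]; nlinarith
  · rintro ⟨hs, h0, h1⟩
    rw [openSegment_eq_image']
    refine ⟨along p q z / along p q q, ⟨by positivity, (div_lt_one hpos).2 h1⟩, ?_⟩
    have hne := hpos.ne'
    ext
    · simp only [Prod.fst_add, Prod.smul_fst, Prod.fst_sub, smul_eq_mul]
      have : along p q z * (q.1 - p.1) = along p q q * (z.1 - p.1) := by
        have := congrArg (· * (q.2 - p.2)) hs
        simp only [side, along] at this ⊢; linear_combination this
      field_simp
      linear_combination this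
    · simp only [Prod.snd_add, Prod.smul_snd, Prod.snd_sub, smul_eq_mul]
      have : along p q z * (q.2 - p.2) = along p q q * (z.2 - p.2) := by
        have := congrArg (· * (q.1 - p.1)) hs
        simp only [side, along] at this ⊢; linear_combination -this
      field_simp
      linear_combination this

theorem side_eq_zero_of_mem_segment {p q z : Plane} (h : z ∈ segment ℝ p q) :
    side p q z = 0 := by
  rw [segment_eq_image'] at h
  obtain ⟨t, -, rfl⟩ := h
  simp only [side, Prod.fst_add, Prod.snd_add, Prod.smul_fst, Prod.smul_snd, Prod.fst_sub,
        Prod.snd_sub, smul_eq_mul]; ring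

theorem isClosed_segment (p q : Plane) : IsClosed (segment ℝ p q) := by
  rw [segment_eq_image_lineMap]
  exact (isCompact_Icc.image (by fun_prop)).isClosed

theorem convex_side_pos (p q : Plane) (σ : ℝ) : Convex ℝ {z | 0 < σ * side p q z} := by
  intro x hx y hy a b ha hb hab
  have e : side p q (a • x + b • y) = a * side p q x + b * side p q y := by
    obtain rfl : b = 1 - a := by linarith
    simp only [side, Prod.fst_add, Prod.snd_add, Prod.smul_fst, Prod.smul_snd, smul_eq_mul]; ring
  simp only [mem_ofPred_eq] at *
  rw [e]
  rcases ha.eq_or_lt with rfl | ha'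
  · have : b = 1 := by linarith
    subst this; linarith
  · have := mul_pos ha' hx
    have := mul_nonneg hb hy.le
    nlinarith

/-- Every neighbourhood of a point of the line `p q` meets both open half-planes. -/
theorem frequently_side_pos {p q x : Plane} (h : p ≠ q) (hx : side p q x = 0) {σ : ℝ}
    (hσ : σ ≠ 0) : ∃ᶠ z in 𝓝 x, 0 < σ * side p q z := by
  have ht : Tendsto (fun t : ℝ => ((x.1 - t * (σ * (q.2 - p.2)), x.2 + t * (σ * (q.1 - p.1))) : Plane))
      (𝓝[>] 0) (𝓝 x) := by
    have : Continuous (fun t : ℝ =>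
        ((x.1 - t * (σ * (q.2 - p.2)), x.2 + t * (σ * (q.1 - p.1))) : Plane)) := by fun_prop
    have := (this.tendsto 0).mono_left (nhdsWithin_le_nhds (s := Ioi 0))
    simpa using this
  refine ht.frequently (Eventually.frequently ?_)
  filter_upwards [self_mem_nhdsWithin] with t ht
  have e : σ * side p q (x.1 - t * (σ * (q.2 - p.2)), x.2 + t * (σ * (q.1 - p.1)))
      = σ * side p q x + t * (σ * σ) * along p q q := by
    simp only [side, along]; ring
  rw [e, hx]
  have := along_self_pos h
  have := mul_self_pos.2 hσ
  have : (0 : ℝ) < t := ht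
  rw [mul_zero, zero_add]
  positivity

/-! ### Complexes of segments and the jumps of a set across them. -/

/-- A finite family of straight line segments in the plane, with ends in a finite set of nodes,
such that no interior point of a segment is a node or lies on another segment. -/
structure SegComplex (ι : Type*) where
  P : ι → Plane
  Q : ι → Plane
  N : Set Plane
  finite_N : N.Finite
  P_mem : ∀ i, P i ∈ N
  Q_mem : ∀ i, Q i ∈ N
  ne : ∀ i, P i ≠ Q i
  disj_node : ∀ i, ∀ z ∈ openSegment ℝ (P i) (Q i), z ∉ N
  disj : ∀ i j, i ≠ j → ∀ z ∈ openSegment ℝ (P i) (Q i), z ∉ segment ℝ (P j) (Q j)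

/-- `A` contains every connected subset of the complement of `K` that it meets. -/
def Saturated (K A : Set Plane) : Prop :=
  ∀ S ⊆ Kᶜ, IsPreconnected S → (S ∩ A).Nonempty → S ⊆ A

namespace SegComplex

variable {ι : Type*} (S : SegComplex ι)

/-- The point set of a complex. -/
def K : Set Plane := S.N ∪ ⋃ i, segment ℝ (S.P i) (S.Q i)

/-- On the side of the segment `i` given by the sign of `σ`, all points near `x` lie in `A`. -/
def Germ (A : Set Plane) (i : ι) (σ : ℝ) (x : Plane) : Prop :=
  ∀ᶠ z in 𝓝 x, 0 < σ * side (S.P i) (S.Q i) z → z ∈ A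

/-- The two sides of the segment `i` near its midpoint are either both in `A` or both outside. -/
def NoJump (A : Set Plane) (i : ι) : Prop :=
  S.Germ A i 1 (midpoint ℝ (S.P i) (S.Q i)) ↔ S.Germ A i (-1) (midpoint ℝ (S.P i) (S.Q i))

theorem midpoint_mem (i : ι) : midpoint ℝ (S.P i) (S.Q i) ∈ openSegment ℝ (S.P i) (S.Q i) := by
  rw [openSegment_eq_image_lineMap]
  exact ⟨1 / 2, by norm_num, by simp [midpoint, invOf_eq_inv]⟩

variable {S}

theorem Germ.exists_mem {A B : Set Plane} {i : ι} {σ : ℝ} (hσ : σ ≠ 0) {x : Plane}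
    (hx : x ∈ openSegment ℝ (S.P i) (S.Q i)) (h : S.Germ A i σ x) (h' : S.Germ B i σ x) :
    ∃ z, z ∈ A ∧ z ∈ B := by
  obtain ⟨z, h1, h2, h3⟩ := ((frequently_side_pos (S.ne i)
    ((mem_openSegment_iff_side_along (S.ne i)).1 hx).1 hσ).and_eventually (h.and h')).exists
  exact ⟨z, h2 h1, h3 h1⟩

theorem Germ.not_germ_compl {A : Set Plane} {i : ι} {σ : ℝ} (hσ : σ ≠ 0) {x : Plane}
    (hx : x ∈ openSegment ℝ (S.P i) (S.Q i)) (h : S.Germ A i σ x) : ¬ S.Germ Aᶜ i σ x := by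
  intro h'
  obtain ⟨z, h1, h2⟩ := h.exists_mem hσ hx h'
  exact h2 h1

theorem mem_openSegment_of_mem_K {y : Plane} (hy : y ∈ S.K) (hyN : y ∉ S.N) :
    ∃ i, y ∈ openSegment ℝ (S.P i) (S.Q i) := by
  rcases hy with h | h
  · exact absurd h hyN
  · obtain ⟨i, hi⟩ := mem_iUnion.1 h
    exact ⟨i, mem_openSegment_of_ne_left_right (fun h => hyN (h ▸ S.P_mem i))
      (fun h => hyN (h ▸ S.Q_mem i)) hi⟩

variable [Finite ι]

variable (S) in
theorem isClosed_K : IsClosed S.K :=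
  S.finite_N.isClosed.union (isClosed_iUnion_of_finite fun _ => isClosed_segment _ _)

/-- The nodes and the other segments form a closed set that misses `x`, so near `x` the complex is
just a straight line. -/
theorem eventually_mem_K_iff {i : ι} {x : Plane} (hx : x ∈ openSegment ℝ (S.P i) (S.Q i)) :
    ∀ᶠ z in 𝓝 x, z ∈ S.K ↔ side (S.P i) (S.Q i) z = 0 := by
  have h1 : ∀ᶠ z in 𝓝 x, z ∉ S.N :=
    S.finite_N.isClosed.isOpen_compl.mem_nhds (S.disj_node i x hx)
  have h2 : ∀ᶠ z in 𝓝 x, ∀ j, j ≠ i → z ∉ segment ℝ (S.P j) (S.Q j) := by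
    rw [eventually_all]
    intro j
    by_cases hj : j = i
    · simp [hj]
    · filter_upwards [(isClosed_segment _ _).isOpen_compl.mem_nhds
        (S.disj i j (Ne.symm hj) x hx)] with z hz _ using hz
  have hx' := (mem_openSegment_iff_side_along (S.ne i)).1 hx
  have h3 := (continuous_along (S.P i) (S.Q i)).continuousAt.eventually (lt_mem_nhds hx'.2.1)
  have h4 := (continuous_along (S.P i) (S.Q i)).continuousAt.eventually (gt_mem_nhds hx'.2.2)
  filter_upwards [h1, h2, h3, h4] with z h1 h2 h3 h4
  constructor
  · rintro (h | h)
    · exact absurd h h1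
    · obtain ⟨j, hj⟩ := mem_iUnion.1 h
      by_cases hji : j = i
      · subst hji; exact side_eq_zero_of_mem_segment hj
      · exact absurd hj (h2 j hji)
  · intro h
    exact Or.inr (mem_iUnion.2 ⟨i, openSegment_subset_segment _ _ _
      ((mem_openSegment_iff_side_along (S.ne i)).2 ⟨h, h3, h4⟩)⟩)

/-- A small half-disc at `x` is convex and misses the complex, so a saturated set that meets it
contains it. -/
theorem germ_of_frequently {A : Set Plane} (hA : Saturated S.K A) {i : ι} {σ : ℝ} {x : Plane}
    (hx : x ∈ openSegment ℝ (S.P i) (S.Q i))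
    (h : ∃ᶠ z in 𝓝 x, 0 < σ * side (S.P i) (S.Q i) z ∧ z ∈ A) : S.Germ A i σ x := by
  obtain ⟨r, hr, hball⟩ := Metric.eventually_nhds_iff_ball.1 (eventually_mem_K_iff hx)
  have hsub := hA (Metric.ball x r ∩ {z | 0 < σ * side (S.P i) (S.Q i) z}) ?_
    ((convex_ball x r).inter (convex_side_pos _ _ _)).isPreconnected ?_
  · filter_upwards [Metric.ball_mem_nhds x hr] with z hz hz' using hsub ⟨hz, hz'⟩
  · rintro z ⟨hz, hz'⟩ hzK
    rw [mem_ofPred_eq, (hball z hz).1 hzK] at hz'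
    simp at hz'
  · obtain ⟨z, ⟨h1, h2⟩, h3⟩ := (h.and_eventually (Metric.ball_mem_nhds x hr)).exists
    exact ⟨z, ⟨h3, h1⟩, h2⟩

theorem germ_or_germ_compl {A : Set Plane} (hA : Saturated S.K A) {i : ι} {σ : ℝ}
    {x : Plane} (hx : x ∈ openSegment ℝ (S.P i) (S.Q i)) : S.Germ A i σ x ∨ S.Germ Aᶜ i σ x := by
  by_cases h : ∃ᶠ z in 𝓝 x, 0 < σ * side (S.P i) (S.Q i) z ∧ z ∈ A
  · exact Or.inl (germ_of_frequently hA hx h)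
  · right
    filter_upwards [not_frequently.1 h] with z hz h1 h2 using hz ⟨h1, h2⟩

/-- The side germ of a saturated set is constant along an open segment. -/
theorem Germ.congr {A : Set Plane} (hA : Saturated S.K A) {i : ι} {σ : ℝ} (hσ : σ ≠ 0)
    {x y : Plane} (hx : x ∈ openSegment ℝ (S.P i) (S.Q i))
    (hy : y ∈ openSegment ℝ (S.P i) (S.Q i)) (h : S.Germ A i σ x) : S.Germ A i σ y := by
  have hpre : IsPreconnected (openSegment ℝ (S.P i) (S.Q i)) := (convex_openSegment _ _).isPreconnected
  -- The points with germ in `A` and those with germ in `Aᶜ` form two disjoint relatively open sets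
  -- covering the connected open segment.
  have := isPreconnected_iff_subset_of_disjoint.1 hpre {x | S.Germ A i σ x} {x | S.Germ Aᶜ i σ x}
    isOpen_setOfPred_eventually_nhds isOpen_setOfPred_eventually_nhds
    (fun z hz => germ_or_germ_compl hA hz) (by
      rw [eq_empty_iff_forall_notMem]
      rintro z ⟨h1, h2, h3⟩
      exact Germ.not_germ_compl hσ h1 h2 h3)
  rcases this with h' | h'
  · exact h' hy
  · exact absurd (h' hx) (h.not_germ_compl hσ hx)

theorem noJump_iff {A : Set Plane} (hA : Saturated S.K A) {i : ι} {x : Plane}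
    (hx : x ∈ openSegment ℝ (S.P i) (S.Q i)) :
    S.NoJump A i ↔ (S.Germ A i 1 x ↔ S.Germ A i (-1) x) := by
  have h (σ : ℝ) (hσ : σ ≠ 0) : S.Germ A i σ (midpoint ℝ (S.P i) (S.Q i)) ↔ S.Germ A i σ x :=
    ⟨fun h => h.congr hA hσ (S.midpoint_mem i) hx, fun h => h.congr hA hσ hx (S.midpoint_mem i)⟩
  unfold NoJump
  rw [h 1 one_ne_zero, h (-1) (by norm_num)]

/-- An open connected set that meets the complex only in interior points of segments without jump
does not separate points of a saturated set from points outside. -/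
theorem subset_or_disjoint {A U : Set Plane} (hA : Saturated S.K A)
    (hUc : IsPreconnected U)
    (hU : ∀ y ∈ U, y ∈ S.K → ∃ i, y ∈ openSegment ℝ (S.P i) (S.Q i) ∧ S.NoJump A i) :
    U \ S.K ⊆ A ∨ Disjoint (U \ S.K) A := by
  -- `U` is split into two open parts: locally, `A` holds all points off the complex, or none. At a
  -- point of the complex, the absence of a jump makes both sides agree.
  have := isPreconnected_iff_subset_of_disjoint.1 hUc {x | ∀ᶠ z in 𝓝 x, z ∉ S.K → z ∈ A}
    {x | ∀ᶠ z in 𝓝 x, z ∉ S.K → z ∉ A}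
    isOpen_setOfPred_eventually_nhds isOpen_setOfPred_eventually_nhds ?_ ?_
  · rcases this with h | h
    · left
      exact fun z hz => (h hz.1).self_of_nhds hz.2
    · right
      exact disjoint_left.2 fun z hz => (h hz.1).self_of_nhds hz.2
  · intro y hy
    by_cases hyK : y ∈ S.K
    · obtain ⟨i, hi, hj⟩ := hU y hy hyK
      rw [noJump_iff hA hi] at hj
      by_cases hg : S.Germ A i 1 y
      · left
        have hg' := hj.1 hg
        filter_upwards [hg, hg', eventually_mem_K_iff hi] with z h1 h2 h3 h4
        rcases lt_or_gt_of_ne (fun h => h4 (h3.2 h)) with h | h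
        · exact h2 (by linarith)
        · exact h1 (by linarith)
      · right
        have hg' := fun h => hg (hj.2 h)
        filter_upwards [(germ_or_germ_compl hA hi).resolve_left hg,
          (germ_or_germ_compl hA hi).resolve_left hg', eventually_mem_K_iff hi] with z h1 h2 h3 h4
        rcases lt_or_gt_of_ne (fun h => h4 (h3.2 h)) with h | h
        · exact h2 (by linarith)
        · exact h1 (by linarith)
    · obtain ⟨r, hr, hball⟩ := Metric.isOpen_iff.1 S.isClosed_K.isOpen_compl y hyK
      by_cases hne : (Metric.ball y r ∩ A).Nonempty
      · left
        have := hA _ hball (convex_ball y r).isPreconnected hne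
        filter_upwards [Metric.ball_mem_nhds y hr] with z hz _ using this hz
      · right
        filter_upwards [Metric.ball_mem_nhds y hr] with z hz _ hzA using hne ⟨z, hz, hzA⟩
  · rw [eq_empty_iff_forall_notMem]
    rintro y ⟨hy, h1, h2⟩
    by_cases hyK : y ∈ S.K
    · obtain ⟨i, hi, hj⟩ := hU y hy hyK
      obtain ⟨z, h3, h4, h5, h6⟩ := ((frequently_side_pos (S.ne i)
        ((mem_openSegment_iff_side_along (S.ne i)).1 hi).1 one_ne_zero).and_eventually
          ((eventually_mem_K_iff hi).and (h1.and h2))).exists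
      have : z ∉ S.K := fun hz => by rw [h4.1 hz] at h3; simp at h3
      exact h6 this (h5 this)
    · exact h2.self_of_nhds hyK (h1.self_of_nhds hyK)

/-- A saturated set without jumps is trivial. -/
theorem compl_subset_or_disjoint {A : Set Plane} (hA : Saturated S.K A)
    (h : ∀ i, S.NoJump A i) : S.Kᶜ ⊆ A ∨ Disjoint S.Kᶜ A := by
  -- The connected set to use is the plane without the nodes: it meets the complex in interior
  -- points of segments only.
  have hc : IsPreconnected (S.Nᶜ) := by
    refine (S.finite_N.countable.isConnected_compl_of_one_lt_rank ?_).isPreconnected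
    rw [rank_prod', Module.rank_self, one_add_one_eq_two]
    exact_mod_cast one_lt_two
  have hN : S.Nᶜ \ S.K = S.Kᶜ := by
    ext z
    simp only [Set.mem_sdiff, mem_compl_iff, and_iff_right_iff_imp]
    exact fun hz hz' => hz (Or.inl hz')
  rw [← hN]
  refine subset_or_disjoint hA hc fun y hy hyK => ?_
  obtain ⟨i, hi⟩ := mem_openSegment_of_mem_K hyK hy
  exact ⟨i, hi, h i⟩

end SegComplex

/-- The slit disc is star-shaped about a point on the ray from `x` opposite to `y`. -/
theorem isPreconnected_ball_diff_segment {x y : Plane} {r : ℝ} (hr : 0 < r) (hxy : r ≤ dist x y) :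
    IsPreconnected (Metric.ball x r \ segment ℝ x y) := by
  have hd : 0 < dist x y := hr.trans_le hxy
  set c : Plane := x - (r / (2 * dist x y)) • (y - x) with hc
  have hcx : c - x = -((r / (2 * dist x y)) • (y - x)) := by rw [hc]; abel
  have hcb : c ∈ Metric.ball x r := by
    rw [mem_ball_iff_norm, hcx, norm_neg, norm_smul, ← dist_eq_norm, dist_comm y x,
      Real.norm_of_nonneg (by positivity)]
    field_simp
    linarith
  have hε : 0 < r / (2 * dist x y) := by positivity
  set ε := r / (2 * dist x y)
  -- As `r ≤ dist x y`, inside the disc the segment coincides with the whole ray, so the bound `t ≤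
  -- 1` can be dropped.
  have key : ∀ w ∈ Metric.ball x r, w ∈ segment ℝ x y ↔ ∃ t : ℝ, 0 ≤ t ∧ w = x + t • (y - x) := by
    intro w hw
    rw [segment_eq_image']
    constructor
    · rintro ⟨t, ht, rfl⟩
      exact ⟨t, ht.1, rfl⟩
    · rintro ⟨t, ht, rfl⟩
      refine ⟨t, ⟨ht, ?_⟩, rfl⟩
      rw [mem_ball_iff_norm, add_sub_cancel_left, norm_smul, Real.norm_of_nonneg ht,
        ← dist_eq_norm, dist_comm y x] at hw
      by_contra! h1
      nlinarith
  have hne : y - x ≠ 0 := by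
    rw [sub_ne_zero]; rintro rfl; simp at hd
  have hcs : c ∉ segment ℝ x y := by
    rw [key c hcb]
    rintro ⟨t, ht, h⟩
    have : (t + ε) • (y - x) = 0 := by
      rw [hc] at h
      have : (t + ε) • (y - x) = (x + t • (y - x)) - (x - ε • (y - x)) := by rw [add_smul]; abel
      rw [this, ← h, sub_self]
    rcases smul_eq_zero.1 this with h | h
    · linarith
    · exact hne h
  have hstar : StarConvex ℝ c (Metric.ball x r \ segment ℝ x y) := by
    intro w hw a b ha hb hab
    have hball := convex_ball x r hcb hw.1 ha hb hab
    refine ⟨hball, fun hmem => ?_⟩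
    rw [key _ hball] at hmem
    obtain ⟨t, ht, h⟩ := hmem
    rcases hb.eq_or_lt with rfl | hb'
    · have : a = 1 := by linarith
      subst this
      apply hcs
      rw [key c hcb]
      exact ⟨t, ht, by simpa using h⟩
    · apply hw.2
      rw [key w hw.1]
      -- Solve `a • c + b • w = x + t • (y - x)` for `w`, using `c = x - ε • (y - x)`: then `w` is
      -- itself on the slit.
      refine ⟨(t + a * ε) / b, by positivity, ?_⟩
      have h2 : b • w = b • x + (t + a * ε) • (y - x) := by
        have e1 : b • w = (a • c + b • w) - a • c := by abel
        have e2 : x = a • x + b • x := by rw [← add_smul, hab, one_smul]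
        rw [e1, h, hc]
        nth_rewrite 1 [e2]
        module
      have h3 : w = b⁻¹ • (b • w) := by rw [smul_smul, inv_mul_cancel₀ hb'.ne', one_smul]
      rw [h3, h2, smul_add, smul_smul, smul_smul, inv_mul_cancel₀ hb'.ne', one_smul, div_eq_inv_mul]
  exact (hstar.isPathConnected ⟨hcb, hcs⟩).isConnected.isPreconnected

namespace SegComplex

variable {ι : Type*} [Finite ι] {S : SegComplex ι}

/-- A small disc about `x`, slit along the segment `i`, is connected and meets only segments without
jump. So `A` fills it or avoids it off the complex, and in particular treats the two sides of `i`
alike. Stating the segment as `x y` up to orientation lets one proof serve both ends. -/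
theorem noJump_of_star {A : Set Plane} (hA : Saturated S.K A) {i : ι} {x y : Plane}
    (hxN : x ∈ S.N) (hxy : x ≠ y) (hseg : segment ℝ x y = segment ℝ (S.P i) (S.Q i))
    (hoseg : openSegment ℝ x y = openSegment ℝ (S.P i) (S.Q i))
    (h : ∀ j, j ≠ i → (x = S.P j ∨ x = S.Q j) → S.NoJump A j) : S.NoJump A i := by
  have h1 : ∀ᶠ z in 𝓝 x, z ∉ S.N \ {x} :=
    (S.finite_N.subset sdiff_subset).isClosed.isOpen_compl.mem_nhds (by simp)
  have h2 : ∀ᶠ z in 𝓝 x, ∀ j, x ∉ segment ℝ (S.P j) (S.Q j) → z ∉ segment ℝ (S.P j) (S.Q j) := by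
    rw [eventually_all]
    intro j
    by_cases hj : x ∈ segment ℝ (S.P j) (S.Q j)
    · simp [hj]
    · filter_upwards [(isClosed_segment _ _).isOpen_compl.mem_nhds hj] with z hz _ using hz
  obtain ⟨r', hr', hball'⟩ := Metric.eventually_nhds_iff_ball.1 (h1.and h2)
  set r := min r' (dist x y)
  have hr : 0 < r := lt_min hr' (dist_pos.2 hxy)
  have hball : ∀ z ∈ Metric.ball x r, _ := fun z hz =>
    hball' z (Metric.ball_subset_ball (min_le_left _ _) hz)
  have hconn := isPreconnected_ball_diff_segment hr (min_le_right r' (dist x y))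
  have hdich := subset_or_disjoint hA hconn ?_
  · -- a point of the open segment in the ball
    obtain ⟨w, hw, hwb⟩ : ∃ w ∈ openSegment ℝ x y, w ∈ Metric.ball x r := by
      have ht : Tendsto (fun t : ℝ => x + t • (y - x)) (𝓝[>] 0) (𝓝 x) := by
        have : Continuous (fun t : ℝ => x + t • (y - x)) := by fun_prop
        simpa using (this.tendsto 0).mono_left (nhdsWithin_le_nhds (s := Ioi 0))
      obtain ⟨t, h3, h4⟩ := ((ht.eventually (Metric.ball_mem_nhds x hr)).and
        (Ioo_mem_nhdsGT (zero_lt_one' ℝ))).exists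
      exact ⟨_, by rw [openSegment_eq_image']; exact ⟨t, h4, rfl⟩, h3⟩
    have hwi := hoseg ▸ hw
    have hnear : ∀ᶠ z in 𝓝 w, side (S.P i) (S.Q i) z ≠ 0 →
        z ∈ (Metric.ball x r \ segment ℝ x y) \ S.K := by
      filter_upwards [eventually_mem_K_iff hwi, Metric.isOpen_ball.mem_nhds hwb] with z h3 h4 h5
      exact ⟨⟨h4, fun hz => h5 (side_eq_zero_of_mem_segment (hseg ▸ hz))⟩, fun hz => h5 (h3.1 hz)⟩
    rw [noJump_iff hA hwi]
    have hs : ∀ σ : ℝ, ∀ z, 0 < σ * side (S.P i) (S.Q i) z → side (S.P i) (S.Q i) z ≠ 0 := by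
      intro σ z hz h0
      rw [h0] at hz; simp at hz
    rcases hdich with hd | hd
    · refine iff_of_true ?_ ?_ <;> filter_upwards [hnear] with z hz h0
      all_goals exact hd (hz (hs _ z h0))
    · have hneg : ∀ σ : ℝ, σ ≠ 0 → ¬ S.Germ A i σ w := fun σ hσ hg => by
        refine hg.not_germ_compl hσ hwi ?_
        filter_upwards [hnear] with z hz h0
        exact disjoint_left.1 hd (hz (hs _ z h0))
      exact iff_of_false (hneg 1 one_ne_zero) (hneg (-1) (by norm_num))
  · rintro z ⟨hz, hzs⟩ hzK
    have hzx : z ≠ x := by rintro rfl; exact hzs (left_mem_segment _ _ _)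
    have hzN : z ∉ S.N := fun hzN => (hball z hz).1 ⟨hzN, hzx⟩
    obtain ⟨j, hj⟩ := mem_openSegment_of_mem_K hzK hzN
    refine ⟨j, hj, h j ?_ ?_⟩
    · rintro rfl
      exact hzs (hseg ▸ openSegment_subset_segment _ _ _ hj)
    · have hxj : x ∈ segment ℝ (S.P j) (S.Q j) := by
        by_contra hxj
        exact (hball z hz).2 j hxj (openSegment_subset_segment _ _ _ hj)
      by_contra! hne
      exact S.disj_node j x (mem_openSegment_of_ne_left_right hne.1.symm hne.2.symm hxj) hxN

/-- At a node, a saturated set cannot jump at exactly one of the segments. -/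
theorem noJump_of_node {A : Set Plane} (hA : Saturated S.K A) {i : ι} {x : Plane}
    (hx : x = S.P i ∨ x = S.Q i)
    (h : ∀ j, j ≠ i → (x = S.P j ∨ x = S.Q j) → S.NoJump A j) : S.NoJump A i := by
  rcases hx with rfl | rfl
  · exact noJump_of_star hA (S.P_mem i) (S.ne i) rfl rfl h
  · exact noJump_of_star hA (S.Q_mem i) (S.ne i).symm (segment_symm _ _ _)
      (openSegment_symm _ _ _) h

end SegComplex

end Doublecross

/-! ### Angles of sight and winding numbers. -/

namespace Doublecross

open Filter Topology Set

/-- A point of the plane as a complex number. -/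
def toC (x : Plane) : ℂ := ⟨x.1, x.2⟩

theorem continuous_toC : Continuous toC :=
  Complex.equivRealProdCLM.symm.continuous

theorem toC_injective : Function.Injective toC := by
  intro x y h
  exact Prod.ext (congrArg Complex.re h) (congrArg Complex.im h)

/-- The oriented angle, in `(-π, π]`, under which the segment from `p` to `q` is seen from `z`. -/
noncomputable def ang (p q z : Plane) : ℝ := Complex.arg ((toC q - toC z) / (toC p - toC z))

/-- The oriented angle at `c` of a point moving from `z₀` to `z`. -/
noncomputable def rel (c z₀ z : Plane) : ℝ := Complex.arg ((toC c - toC z) / (toC c - toC z₀))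

theorem toC_sub_ne_zero {p z : Plane} (h : z ≠ p) : toC p - toC z ≠ 0 :=
  sub_ne_zero.2 fun h' => h (toC_injective h').symm

/-- If the quotient were a real number `w ≤ 0`, then `z` would be the convex combination of `p` and
`q` with weights `-w / (1 - w)` and `1 / (1 - w)`. Hence `ang` is continuous off the segment. -/
theorem div_mem_slitPlane {p q z : Plane} (hz : z ∉ segment ℝ p q) :
    (toC q - toC z) / (toC p - toC z) ∈ Complex.slitPlane := by
  have hp : toC p - toC z ≠ 0 := toC_sub_ne_zero (by rintro rfl; exact hz (left_mem_segment _ _ _))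
  by_contra hs
  rw [Complex.mem_slitPlane_iff] at hs
  push Not at hs
  obtain ⟨h1, h2⟩ := hs
  set w := (toC q - toC z) / (toC p - toC z) with hw
  have h3 : toC q - toC z = (w.re : ℂ) * (toC p - toC z) := by
    have : (w.re : ℂ) = w := Complex.ext (by simp) (by simp [h2])
    rw [this, hw, div_mul_cancel₀ _ hp]
  have hre := congrArg Complex.re h3
  have him := congrArg Complex.im h3
  simp only [toC, Complex.sub_re, Complex.sub_im, Complex.re_ofReal_mul,
    Complex.im_ofReal_mul] at hre him
  apply hz
  have hpos : 0 < 1 - w.re := by linarith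
  refine ⟨-w.re / (1 - w.re), 1 / (1 - w.re), div_nonneg (by linarith) hpos.le, by positivity,
    by rw [← add_div, div_eq_one_iff_eq hpos.ne']; ring, ?_⟩
  ext
  · simp only [Prod.fst_add, Prod.smul_fst, smul_eq_mul]
    field_simp
    linear_combination hre
  · simp only [Prod.snd_add, Prod.smul_snd, smul_eq_mul]
    field_simp
    linear_combination him

theorem continuousAt_ang {p q z : Plane} (hz : z ∉ segment ℝ p q) : ContinuousAt (ang p q) z := by
  have hp : toC p - toC z ≠ 0 := toC_sub_ne_zero (by rintro rfl; exact hz (left_mem_segment _ _ _))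
  refine ContinuousAt.comp (f := fun z => (toC q - toC z) / (toC p - toC z))
    (Complex.continuousAt_arg (div_mem_slitPlane hz)) ?_
  have := continuous_toC.continuousAt (x := z)
  exact (continuousAt_const.sub this).div (continuousAt_const.sub this) hp

theorem rel_self (c z₀ : Plane) : rel c z₀ z₀ = 0 := by
  unfold rel
  by_cases h : toC c - toC z₀ = 0
  · simp [h]
  · simp [div_self h]

theorem continuousAt_rel {c z₀ : Plane} (h : z₀ ≠ c) : ContinuousAt (rel c z₀) z₀ := by
  have hp := toC_sub_ne_zero h
  refine ContinuousAt.comp (f := fun z => (toC c - toC z) / (toC c - toC z₀))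
    (Complex.continuousAt_arg (by simp [div_self hp])) ?_
  have := continuous_toC.continuousAt (x := z₀)
  exact (continuousAt_const.sub this).div continuousAt_const hp

/-- Near a point off the segment, the angle of sight splits into contributions of the ends. -/
theorem ang_eventuallyEq {p q z₀ : Plane} (hz : z₀ ∉ segment ℝ p q) :
    ∀ᶠ z in 𝓝 z₀, ang p q z = ang p q z₀ + (rel q z₀ z - rel p z₀ z) := by
  have hp : z₀ ≠ p := by rintro rfl; exact hz (left_mem_segment _ _ _)
  have hq : z₀ ≠ q := by rintro rfl; exact hz (right_mem_segment _ _ _)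
  -- The defect `D` is continuous at `z₀`, vanishes there, and takes values in `2πℤ` because
  -- arguments of quotients subtract modulo `2π`. So it vanishes nearby.
  set D := fun z => ang p q z - ang p q z₀ - (rel q z₀ z - rel p z₀ z) with hD
  have hc : ContinuousAt D z₀ := by
    have h1 := continuousAt_ang hz
    have h2 := continuousAt_rel hp
    have h3 := continuousAt_rel hq
    exact (h1.sub continuousAt_const).sub (h3.sub h2)
  have h0 : D z₀ = 0 := by simp [hD, rel_self]
  have hsmall : ∀ᶠ z in 𝓝 z₀, |D z| < 2 * Real.pi := by
    have := hc.abs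
    refine this.eventually (gt_mem_nhds ?_)
    simp only [h0, abs_zero]; positivity
  filter_upwards [hsmall, isOpen_ne.mem_nhds hp, isOpen_ne.mem_nhds hq] with z h1 h2 h3
  have a1 := toC_sub_ne_zero hp
  have a2 := toC_sub_ne_zero hq
  have a3 := toC_sub_ne_zero h2
  have a4 := toC_sub_ne_zero h3
  have hangle : ((D z : ℝ) : Real.Angle) = 0 := by
    simp only [hD, ang, rel, Real.Angle.coe_sub]
    rw [Complex.arg_div_coe_angle a4 a3, Complex.arg_div_coe_angle a2 a1,
      Complex.arg_div_coe_angle a4 a2, Complex.arg_div_coe_angle a3 a1]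
    abel
  rw [Real.Angle.coe_eq_zero_iff] at hangle
  obtain ⟨n, hn⟩ := hangle
  have hn0 : n = 0 := by
    by_contra hne
    have h1' : (1 : ℝ) ≤ |(n : ℝ)| := by exact_mod_cast Int.one_le_abs hne
    rw [← hn, zsmul_eq_mul, abs_mul, abs_of_pos Real.two_pi_pos] at h1
    nlinarith [Real.two_pi_pos]
  rw [hn0, zero_smul] at hn
  simp only [hD] at hn
  linarith

/-- The side of the line on which `z` lies decides from which side the quotient approaches the
branch cut of `arg`. -/
theorem im_div_eq_side (p q z : Plane) : ((toC q - toC z) / (toC p - toC z)).im =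
    side p q z / Complex.normSq (toC p - toC z) := by
  rw [Complex.div_im, ← sub_div]
  simp only [toC, side, Complex.sub_re, Complex.sub_im]
  congr 1
  ring

theorem tendsto_ang {p q m : Plane} (hpq : p ≠ q) (hm : m ∈ openSegment ℝ p q) :
    Tendsto (ang p q) (𝓝[{z | 0 < side p q z}] m) (𝓝 Real.pi) ∧
    Tendsto (ang p q) (𝓝[{z | side p q z < 0}] m) (𝓝 (-Real.pi)) := by
  have hmp : m ≠ p := by rintro rfl; exact hpq (left_mem_openSegment_iff.1 hm)
  have hp := toC_sub_ne_zero hmp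
  have hcont : ContinuousAt (fun z => (toC q - toC z) / (toC p - toC z)) m := by
    have := continuous_toC.continuousAt (x := m)
    exact (continuousAt_const.sub this).div (continuousAt_const.sub this) hp
  have him : ((toC q - toC m) / (toC p - toC m)).im = 0 := by
    rw [im_div_eq_side, ((mem_openSegment_iff_side_along hpq).1 hm).1, zero_div]
  have hre : ((toC q - toC m) / (toC p - toC m)).re < 0 := by
    rw [openSegment_eq_image'] at hm
    obtain ⟨t, ⟨ht0, ht1⟩, rfl⟩ := hm
    have hd : toC p - toC q ≠ 0 := toC_sub_ne_zero hpq.symm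
    have e : (toC q - toC (p + t • (q - p))) / (toC p - toC (p + t • (q - p)))
        = ((-(1 - t) / t : ℝ) : ℂ) := by
      have e1 : toC q - toC (p + t • (q - p)) = ((-(1 - t) : ℝ) : ℂ) * (toC p - toC q) := by
        apply Complex.ext <;> simp [toC] <;> ring
      have e2 : toC p - toC (p + t • (q - p)) = ((t : ℝ) : ℂ) * (toC p - toC q) := by
        apply Complex.ext <;> simp [toC] <;> ring
      rw [e1, e2, mul_div_mul_right _ _ hd, Complex.ofReal_div]
    rw [e, Complex.ofReal_re]
    exact div_neg_of_neg_of_pos (by linarith) ht0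
  have hnear : ∀ᶠ z in 𝓝 m, 0 < Complex.normSq (toC p - toC z) := by
    filter_upwards [isOpen_ne.mem_nhds hmp] with z hz
    exact Complex.normSq_pos.2 (toC_sub_ne_zero hz)
  constructor
  · refine (Complex.tendsto_arg_nhdsWithin_im_nonneg_of_re_neg_of_im_zero hre him).comp
      (tendsto_nhdsWithin_iff.2 ⟨hcont.tendsto.mono_left nhdsWithin_le_nhds, ?_⟩)
    filter_upwards [self_mem_nhdsWithin, nhdsWithin_le_nhds hnear] with z h1 h2
    have h1 : 0 < side p q z := h1
    simp only [im_div_eq_side]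
    positivity
  · refine (Complex.tendsto_arg_nhdsWithin_im_neg_of_re_neg_of_im_zero hre him).comp
      (tendsto_nhdsWithin_iff.2 ⟨hcont.tendsto.mono_left nhdsWithin_le_nhds, ?_⟩)
    filter_upwards [self_mem_nhdsWithin, nhdsWithin_le_nhds hnear] with z h1 h2
    simp only [im_div_eq_side]
    exact div_neg_of_neg_of_pos h1 h2

namespace SegComplex

variable {ι : Type*} (S : SegComplex ι)

theorem notMem_segment_of_notMem_K {z : Plane} (hz : z ∉ S.K) (i : ι) :
    z ∉ segment ℝ (S.P i) (S.Q i) := fun h => hz (Or.inr (mem_iUnion.2 ⟨i, h⟩))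

variable [Fintype ι]

/-- The total angle under which the segments, weighted by `f`, are seen from `z`. -/
noncomputable def wind (f : ι → ℝ) (z : Plane) : ℝ := ∑ i, f i * ang (S.P i) (S.Q i) z

/-- If the weights are balanced at the ends, then the total angle is locally constant. -/
theorem wind_eventuallyEq (f : ι → ℝ) (hf : ∀ g : Plane → ℝ, ∑ i, f i * (g (S.Q i) - g (S.P i)) = 0)
    {z₀ : Plane} (hz : z₀ ∉ S.K) : ∀ᶠ z in 𝓝 z₀, S.wind f z = S.wind f z₀ := by
  have h : ∀ᶠ z in 𝓝 z₀, ∀ i, ang (S.P i) (S.Q i) z =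
      ang (S.P i) (S.Q i) z₀ + (rel (S.Q i) z₀ z - rel (S.P i) z₀ z) :=
    eventually_all.2 fun i => ang_eventuallyEq (S.notMem_segment_of_notMem_K hz i)
  filter_upwards [h] with z h
  unfold wind
  simp only [h, mul_add, Finset.sum_add_distrib]
  -- Balance at the ends, applied to the angle swept at each end, cancels every change.
  rw [hf (fun c => rel c z₀ z), add_zero]

theorem wind_eq_of_isPreconnected (f : ι → ℝ)
    (hf : ∀ g : Plane → ℝ, ∑ i, f i * (g (S.Q i) - g (S.P i)) = 0)
    {T : Set Plane} (hT : IsPreconnected T) (hTK : T ⊆ S.Kᶜ) {x y : Plane} (hx : x ∈ T)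
    (hy : y ∈ T) : S.wind f x = S.wind f y := by
  have := isPreconnected_iff_subset_of_disjoint.1 hT
    {z | ∀ᶠ w in 𝓝 z, S.wind f w = S.wind f x} {z | ∀ᶠ w in 𝓝 z, S.wind f w ≠ S.wind f x}
    isOpen_setOfPred_eventually_nhds isOpen_setOfPred_eventually_nhds ?_ ?_
  · rcases this with h | h
    · exact (h hy).self_of_nhds.symm
    · exact absurd rfl (h hx).self_of_nhds
  · intro z hz
    have h1 := S.wind_eventuallyEq f hf (hTK hz)
    by_cases h : S.wind f z = S.wind f x
    · left
      filter_upwards [h1] with w hw using hw.trans h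
    · right
      filter_upwards [h1] with w hw using fun h' => h (hw.symm.trans h')
  · rw [eq_empty_iff_forall_notMem]
    rintro z ⟨-, h1, h2⟩
    exact h2.self_of_nhds h1.self_of_nhds

/-- The total angle jumps by `2 π` times the weight across a segment. -/
theorem weight_eq_zero_of_wind_const (f : ι → ℝ) (c : ℝ) (h : ∀ z, z ∉ S.K → S.wind f z = c)
    (i : ι) : f i = 0 := by
  classical
  set m := midpoint ℝ (S.P i) (S.Q i)
  have hm := S.midpoint_mem i
  -- All other terms are continuous at the midpoint of `i`. Comparing the two one-sided limits of
  -- the constant total leaves `f i * π = f i * (-π)`.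
  set R := fun z => ∑ j ∈ Finset.univ.erase i, f j * ang (S.P j) (S.Q j) z with hR
  have hRc : ContinuousAt R m := by
    refine tendsto_finsetSum _ fun j hj => ?_
    exact (continuousAt_const.mul (continuousAt_ang
      (S.disj i j (Finset.ne_of_mem_erase hj).symm m hm)))
  have hW : ∀ z, S.wind f z = f i * ang (S.P i) (S.Q i) z + R z := fun z =>
    (Finset.add_sum_erase _ _ (Finset.mem_univ i)).symm
  obtain ⟨t1, t2⟩ := tendsto_ang (S.ne i) hm
  have hside := ((mem_openSegment_iff_side_along (S.ne i)).1 hm).1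
  have l1 : f i * Real.pi + R m = c := by
    have : NeBot (𝓝[{z | 0 < side (S.P i) (S.Q i) z}] m) := by
      refine frequently_mem_iff_neBot.1 ?_
      simpa using frequently_side_pos (S.ne i) hside one_ne_zero
    refine tendsto_nhds_unique ((t1.const_mul (f i)).add
      (hRc.tendsto.mono_left nhdsWithin_le_nhds)) (tendsto_const_nhds.congr' ?_)
    filter_upwards [self_mem_nhdsWithin, nhdsWithin_le_nhds (eventually_mem_K_iff hm)] with z h1 h2
    rw [← hW, h z]
    intro hz
    exact (ne_of_gt h1) (h2.1 hz)
  have l2 : f i * (-Real.pi) + R m = c := by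
    have : NeBot (𝓝[{z | side (S.P i) (S.Q i) z < 0}] m) := by
      refine frequently_mem_iff_neBot.1 ?_
      have := frequently_side_pos (S.ne i) hside (neg_ne_zero.2 (one_ne_zero (α := ℝ)))
      simpa using this
    refine tendsto_nhds_unique ((t2.const_mul (f i)).add
      (hRc.tendsto.mono_left nhdsWithin_le_nhds)) (tendsto_const_nhds.congr' ?_)
    filter_upwards [self_mem_nhdsWithin, nhdsWithin_le_nhds (eventually_mem_K_iff hm)] with z h1 h2
    rw [← hW, h z]
    intro hz
    exact (ne_of_lt h1) (h2.1 hz)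
  have : f i * Real.pi = 0 := by linarith
  exact (mul_eq_zero.1 this).resolve_right Real.pi_ne_zero

end SegComplex

end Doublecross

/-! ### From drawings to segment complexes. -/

namespace Doublecross

open Filter Topology Set

variable {V : Type*} {H : SimpleGraph V}

/-- A choice of vertices for the polygonal arcs of a drawing, together with orientations. -/
structure Polygons (D : PlaneDrawing H) where
  tl : H.edgeSet → V
  hd : H.edgeSet → V
  n : H.edgeSet → ℕ
  p : H.edgeSet → ℕ → Plane
  edge_eq : ∀ e, e.1 = s(tl e, hd e)
  n_pos : ∀ e, 0 < n e
  p_zero : ∀ e, p e 0 = D.pos (tl e)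
  p_last : ∀ e, p e (n e) = D.pos (hd e)
  p_ne : ∀ e, ∀ k < n e, p e k ≠ p e (k + 1)
  p_inter : ∀ e i j, i < j → j < n e → ∀ z ∈ segment ℝ (p e i) (p e (i + 1)),
    z ∈ segment ℝ (p e j) (p e (j + 1)) → i + 1 = j ∧ z = p e (i + 1)
  mem_arc : ∀ e z, z ∈ D.arc e.1 ↔ ∃ k < n e, z ∈ segment ℝ (p e k) (p e (k + 1))

theorem exists_polygons (D : PlaneDrawing H) : Nonempty (Polygons D) := by
  have key : ∀ e : H.edgeSet, ∃ (a b : V) (n : ℕ) (p : ℕ → Plane), e.1 = s(a, b) ∧ 0 < n ∧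
      p 0 = D.pos a ∧ p n = D.pos b ∧ (∀ k < n, p k ≠ p (k + 1)) ∧
      (∀ i j, i < j → j < n → ∀ z ∈ segment ℝ (p i) (p (i + 1)),
        z ∈ segment ℝ (p j) (p (j + 1)) → i + 1 = j ∧ z = p (i + 1)) ∧
      (∀ z, z ∈ D.arc e.1 ↔ ∃ k < n, z ∈ segment ℝ (p k) (p (k + 1))) := by
    rintro ⟨e, he⟩
    induction e with | _ a b
    obtain ⟨n, p, h0, hx, hy, hne, hmeet, hA⟩ := D.isPolygonalArc a b he
    -- Indices beyond `n` wrap around modulo `n + 1`; only the values up to `n` matter.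
    set p' : ℕ → Plane := fun k => p (Fin.ofNat (n + 1) k) with hp'
    have c1 : ∀ k (hk : k < n), p' k = p (Fin.castSucc ⟨k, hk⟩) := fun k hk => by
      simp only [hp']; congr 1; ext; simp [Fin.ofNat, Nat.mod_eq_of_lt (Nat.lt_succ_of_lt hk)]
    have c2 : ∀ k (hk : k < n), p' (k + 1) = p (Fin.succ ⟨k, hk⟩) := fun k hk => by
      simp only [hp']; congr 1; ext; simp [Fin.ofNat, Nat.mod_eq_of_lt (Nat.succ_lt_succ hk)]
    refine ⟨a, b, n, p', rfl, h0, ?_, ?_, ?_, ?_, ?_⟩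
    · rw [← hx]; simp only [hp']; congr 1
    · rw [← hy]; simp only [hp']; congr 1; ext; simp [Fin.ofNat]
    · intro k hk
      rw [c1 k hk, c2 k hk]
      exact hne _
    · intro i j hij hj z
      rw [c1 i (hij.trans hj), c2 i (hij.trans hj), c1 j hj, c2 j hj]
      intro h1 h2
      obtain ⟨h3, h4⟩ := hmeet _ _ (by simpa using hij) z h1 h2
      exact ⟨by simpa [Fin.ext_iff] using h3, h4⟩
    · intro z
      rw [hA, mem_iUnion]
      constructor
      · rintro ⟨k, hk⟩
        exact ⟨k, k.2, by rwa [c1 k k.2, c2 k k.2]⟩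
      · rintro ⟨k, hk, h⟩
        rw [c1 k hk, c2 k hk] at h
        exact ⟨_, h⟩
  choose a b n p h1 h2 h3 h4 h5 h6 h7 using key
  exact ⟨⟨a, b, n, p, h1, h2, h3, h4, h5, h6, h7⟩⟩

namespace Polygons

variable {D : PlaneDrawing H} (Γ : Polygons D)

theorem p_injOn (e : H.edgeSet) {i j : ℕ} (hj : j ≤ Γ.n e) (hij : i < j) : Γ.p e i ≠ Γ.p e j := by
  intro h
  rcases Nat.lt_or_ge (i + 1) j with h1 | h1
  · obtain ⟨k, rfl⟩ : ∃ k, j = k + 1 := ⟨j - 1, by omega⟩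
    obtain ⟨h2, h3⟩ := Γ.p_inter e i k (by omega) (by omega) (Γ.p e i) (left_mem_segment _ _ _)
      (h ▸ right_mem_segment _ _ _)
    exact Γ.p_ne e i (by omega) h3
  · obtain rfl : j = i + 1 := by omega
    exact Γ.p_ne e i (by omega) h

theorem eq_of_p_eq (e : H.edgeSet) {i j : ℕ} (hi : i ≤ Γ.n e) (hj : j ≤ Γ.n e)
    (h : Γ.p e i = Γ.p e j) : i = j := by
  rcases lt_trichotomy i j with h1 | h1 | h1
  · exact absurd h (Γ.p_injOn e hj h1)
  · exact h1
  · exact absurd h.symm (Γ.p_injOn e hi h1)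

theorem p_mem_arc (e : H.edgeSet) {k : ℕ} (hk : k ≤ Γ.n e) : Γ.p e k ∈ D.arc e.1 := by
  rw [Γ.mem_arc]
  have := Γ.n_pos e
  rcases hk.lt_or_eq with h | h
  · exact ⟨k, h, left_mem_segment _ _ _⟩
  · refine ⟨k - 1, by omega, ?_⟩
    rw [show k - 1 + 1 = k by omega]
    exact right_mem_segment _ _ _

theorem mem_edge_iff (e : H.edgeSet) (v : V) : v ∈ e.1 ↔ v = Γ.tl e ∨ v = Γ.hd e := by
  rw [Γ.edge_eq e, Sym2.mem_iff]

/-- A vertex on the arc of `e` is the initial or the final vertex of the polygon of `e`. -/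
theorem pos_mem_arc (e : H.edgeSet) {v : V} (h : D.pos v ∈ D.arc e.1) :
    (v = Γ.tl e ∧ D.pos v = Γ.p e 0) ∨ (v = Γ.hd e ∧ D.pos v = Γ.p e (Γ.n e)) := by
  rcases (Γ.mem_edge_iff e v).1 (D.mem_of_pos_mem e.1 e.2 v h) with h | h
  · exact Or.inl ⟨h, by rw [Γ.p_zero, h]⟩
  · exact Or.inr ⟨h, by rw [Γ.p_last, h]⟩

theorem p_notMem_openSegment (e : H.edgeSet) {k i : ℕ} (hk : k ≤ Γ.n e) (hi : i < Γ.n e) :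
    Γ.p e k ∉ openSegment ℝ (Γ.p e i) (Γ.p e (i + 1)) := by
  intro h
  have hs := openSegment_subset_segment _ _ _ h
  rcases lt_trichotomy k i with h1 | h1 | h1
  · obtain ⟨h2, h3⟩ := Γ.p_inter e k i h1 hi _ (left_mem_segment _ _ _) hs
    exact Γ.p_ne e k (by omega) h3
  · subst h1
    exact Γ.p_ne e k hi (left_mem_openSegment_iff.1 h)
  · rcases Nat.lt_or_ge (i + 1) k with h4 | h4
    · obtain ⟨k, rfl⟩ : ∃ l, k = l + 1 := ⟨k - 1, by omega⟩
      obtain ⟨h2, h3⟩ := Γ.p_inter e i k (by omega) (by omega) _ hs (right_mem_segment _ _ _)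
      rw [h2] at h3
      exact Γ.p_ne e k (by omega) h3.symm
    · obtain rfl : k = i + 1 := by omega
      exact Γ.p_ne e i hi (right_mem_openSegment_iff.1 h)

theorem segment_subset_arc (e : H.edgeSet) {k : ℕ} (hk : k < Γ.n e) :
    segment ℝ (Γ.p e k) (Γ.p e (k + 1)) ⊆ D.arc e.1 := fun z hz => (Γ.mem_arc e z).2 ⟨k, hk, hz⟩

/-- An interior point of a segment of `e` lies on no other arc. -/
theorem eq_of_mem_openSegment {e e' : H.edgeSet} {i : ℕ} (hi : i < Γ.n e) {z : Plane}
    (hz : z ∈ openSegment ℝ (Γ.p e i) (Γ.p e (i + 1))) (hz' : z ∈ D.arc e'.1) : e' = e := by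
  by_contra hne
  obtain ⟨w, hw, -, rfl⟩ := D.arc_inter e.1 e.2 e'.1 e'.2 (fun h => hne (Subtype.ext h.symm)) z
    (Γ.segment_subset_arc e hi (openSegment_subset_segment _ _ _ hz)) hz'
  rcases Γ.pos_mem_arc e (Γ.segment_subset_arc e hi (openSegment_subset_segment _ _ _ hz))
    with ⟨-, h⟩ | ⟨-, h⟩ <;> rw [h] at hz
  · exact Γ.p_notMem_openSegment e (Nat.zero_le _) hi hz
  · exact Γ.p_notMem_openSegment e le_rfl hi hz

/-- The nodes of the complex of a drawing. -/
def nodes : Set Plane := range D.pos ∪ range fun x : Σ e, Fin (Γ.n e + 1) => Γ.p x.1 x.2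

theorem notMem_nodes {e : H.edgeSet} {i : ℕ} (hi : i < Γ.n e) {z : Plane}
    (hz : z ∈ openSegment ℝ (Γ.p e i) (Γ.p e (i + 1))) : z ∉ Γ.nodes := by
  have hza := Γ.segment_subset_arc e hi (openSegment_subset_segment _ _ _ hz)
  rintro (⟨v, rfl⟩ | ⟨⟨e', k⟩, rfl⟩)
  · rcases Γ.pos_mem_arc e hza with ⟨-, h⟩ | ⟨-, h⟩ <;> rw [h] at hz
    · exact Γ.p_notMem_openSegment e (Nat.zero_le _) hi hz
    · exact Γ.p_notMem_openSegment e le_rfl hi hz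
  · obtain rfl := Γ.eq_of_mem_openSegment hi hz (Γ.p_mem_arc e' (Nat.lt_succ_iff.1 k.2))
    exact Γ.p_notMem_openSegment e' (Nat.lt_succ_iff.1 k.2) hi hz

variable [Finite V]

/-- The segments of a drawing. -/
def complex : SegComplex (Σ e, Fin (Γ.n e)) where
  P x := Γ.p x.1 x.2
  Q x := Γ.p x.1 (x.2 + 1)
  N := Γ.nodes
  finite_N := (finite_range _).union (finite_range _)
  P_mem x := Or.inr ⟨⟨x.1, x.2.castSucc⟩, rfl⟩
  Q_mem x := Or.inr ⟨⟨x.1, x.2.succ⟩, rfl⟩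
  ne x := Γ.p_ne x.1 x.2 x.2.2
  disj_node x z hz := Γ.notMem_nodes x.2.2 hz
  disj := by
    rintro ⟨e, i⟩ ⟨e', j⟩ hne z hz hz'
    obtain rfl := Γ.eq_of_mem_openSegment i.2 hz (Γ.segment_subset_arc e' j.2 hz')
    have hij : (i : ℕ) ≠ j := fun h => hne (by rw [Fin.ext h])
    have hnode : ∀ k ≤ Γ.n e', z ≠ Γ.p e' k := fun k hk h =>
      Γ.p_notMem_openSegment e' hk i.2 (h ▸ hz)
    rcases lt_or_gt_of_ne hij with h | h
    · exact hnode _ i.2 (Γ.p_inter e' i j h j.2 z (openSegment_subset_segment _ _ _ hz) hz').2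
    · exact hnode _ j.2 (Γ.p_inter e' j i h i.2 z hz' (openSegment_subset_segment _ _ _ hz)).2

theorem complex_K : Γ.complex.K = D.carrier := by
  ext z
  simp only [SegComplex.K, PlaneDrawing.carrier, complex, mem_union, mem_iUnion]
  constructor
  · rintro ((h | ⟨⟨e, k⟩, rfl⟩) | ⟨⟨e, k⟩, h⟩)
    · exact Or.inl h
    · exact Or.inr ⟨e.1, e.2, Γ.p_mem_arc e (Nat.lt_succ_iff.1 k.2)⟩
    · exact Or.inr ⟨e.1, e.2, Γ.segment_subset_arc e k.2 h⟩
  · rintro (h | ⟨e, he, h⟩)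
    · exact Or.inl (Or.inl h)
    · obtain ⟨k, hk, h'⟩ := (Γ.mem_arc ⟨e, he⟩ z).1 h
      exact Or.inr ⟨⟨⟨e, he⟩, ⟨k, hk⟩⟩, h'⟩

/-- The first segment of an edge. -/
def fst (e : H.edgeSet) : Σ e, Fin (Γ.n e) := ⟨e, ⟨0, Γ.n_pos e⟩⟩

/-- The edges across which a set jumps. -/
def bd (A : Set Plane) : Set H.edgeSet := {e | ¬ Γ.complex.NoJump A (Γ.fst e)}

variable {A : Set Plane}

/-- At an inner vertex of a polygon, a saturated set jumps at both segments or at none. -/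
theorem noJump_succ_iff (hA : Saturated Γ.complex.K A) (e : H.edgeSet) {k : ℕ} (hk : k + 1 < Γ.n e) :
    Γ.complex.NoJump A ⟨e, ⟨k, by omega⟩⟩ ↔ Γ.complex.NoJump A ⟨e, ⟨k + 1, hk⟩⟩ := by
  -- An inner vertex of a polygon is an end of just two segments of the whole drawing: another arc
  -- could pass through it only at a vertex of the graph, which on `e` has index `0` or `n e`.
  have key : ∀ y : Σ e, Fin (Γ.n e), (Γ.p e (k + 1) = Γ.complex.P y ∨
      Γ.p e (k + 1) = Γ.complex.Q y) →
      y = ⟨e, ⟨k, by omega⟩⟩ ∨ y = ⟨e, ⟨k + 1, hk⟩⟩ := by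
    rintro ⟨e', j⟩ hy
    have hmem : Γ.p e (k + 1) ∈ D.arc e'.1 := by
      rcases hy with h | h <;> rw [h]
      · exact Γ.p_mem_arc e' j.2.le
      · exact Γ.p_mem_arc e' j.2
    obtain rfl : e' = e := by
      by_contra hne
      obtain ⟨w, hw, -, h⟩ := D.arc_inter e.1 e.2 e'.1 e'.2 (fun h => hne (Subtype.ext h.symm)) _
        (Γ.p_mem_arc e hk.le) hmem
      have h2 := Γ.p_mem_arc e hk.le
      rw [h] at h2
      rcases Γ.pos_mem_arc e h2 with ⟨-, h3⟩ | ⟨-, h3⟩ <;> rw [← h] at h3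
      · have := Γ.eq_of_p_eq e hk.le (Nat.zero_le _) h3; omega
      · have := Γ.eq_of_p_eq e hk.le le_rfl h3; omega
    rcases hy with h | h
    · right
      have := Γ.eq_of_p_eq e' hk.le j.2.le h
      congr 1; ext; exact this.symm
    · left
      have := Γ.eq_of_p_eq e' hk.le j.2 h
      congr 1; ext; simp only; omega
  constructor <;> intro h
  · refine SegComplex.noJump_of_node hA (x := Γ.p e (k + 1)) (Or.inl rfl) fun j hj hj' => ?_
    rcases key j hj' with rfl | rfl
    · exact h
    · exact absurd rfl hj
  · refine SegComplex.noJump_of_node hA (x := Γ.p e (k + 1)) (Or.inr rfl) fun j hj hj' => ?_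
    rcases key j hj' with rfl | rfl
    · exact absurd rfl hj
    · exact h

theorem noJump_iff_notMem_bd (hA : Saturated Γ.complex.K A) (e : H.edgeSet) (k : Fin (Γ.n e)) :
    Γ.complex.NoJump A ⟨e, k⟩ ↔ e ∉ Γ.bd A := by
  obtain ⟨k, hk⟩ := k
  simp only [bd, mem_ofPred_eq, not_not, fst]
  induction k with
  | zero => rfl
  | succ k ih => exact (Γ.noJump_succ_iff hA e hk).symm.trans (ih (by omega))

/-- No vertex is an end of exactly one edge across which a saturated set jumps. -/
theorem exists_mem_bd_of_mem_bd (hA : Saturated Γ.complex.K A) {e : H.edgeSet}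
    (he : e ∈ Γ.bd A) {v : V} (hv : v ∈ e.1) :
    ∃ e' ∈ Γ.bd A, e' ≠ e ∧ v ∈ e'.1 := by
  by_contra! hcon
  have hn := Γ.n_pos e
  -- Exactly one segment of `e` ends at `v`, the first or the last. If no other edge jumped at `v`,
  -- it would be the only segment there with a jump.
  obtain ⟨i, hi, hi'⟩ : ∃ i : Fin (Γ.n e), (D.pos v = Γ.complex.P ⟨e, i⟩ ∨
      D.pos v = Γ.complex.Q ⟨e, i⟩) ∧ ∀ j : Fin (Γ.n e), (D.pos v = Γ.complex.P ⟨e, j⟩ ∨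
      D.pos v = Γ.complex.Q ⟨e, j⟩) → j = i := by
    rcases (Γ.mem_edge_iff e v).1 hv with h | h
    · refine ⟨⟨0, hn⟩, Or.inl ?_, ?_⟩
      · rw [h]; exact (Γ.p_zero e).symm
      · rw [h, ← Γ.p_zero e]
        rintro j (h | h)
        · have := Γ.eq_of_p_eq e (Nat.zero_le _) j.2.le h
          ext; exact this.symm
        · have := Γ.eq_of_p_eq e (Nat.zero_le _) j.2 h
          simp at this
    · refine ⟨⟨Γ.n e - 1, by omega⟩, Or.inr ?_, ?_⟩
      · rw [h, ← Γ.p_last e]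
        simp only [complex]
        rw [show Γ.n e - 1 + 1 = Γ.n e by omega]
      · rw [h, ← Γ.p_last e]
        rintro j (h | h)
        · have := Γ.eq_of_p_eq e le_rfl j.2.le h
          omega
        · have := Γ.eq_of_p_eq e le_rfl j.2 h
          ext; simp only; omega
  refine absurd ?_ ((Γ.noJump_iff_notMem_bd hA e i).not.2 (not_not.2 he))
  refine SegComplex.noJump_of_node hA hi ?_
  rintro ⟨e', j⟩ hj hj'
  rw [Γ.noJump_iff_notMem_bd hA]
  have hne : e' ≠ e := by
    rintro rfl
    exact hj (by rw [hi' j hj'])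
  intro hb
  refine hcon e' hb hne (D.mem_of_pos_mem e'.1 e'.2 v ?_)
  rcases hj' with h | h <;> rw [h]
  · exact Γ.p_mem_arc e' j.2.le
  · exact Γ.p_mem_arc e' j.2

/-- A saturated set across whose boundary nothing jumps is trivial. -/
theorem compl_subset_or_disjoint_of_bd_eq_empty (hA : Saturated Γ.complex.K A)
    (h : Γ.bd A = ∅) :
    Γ.complex.Kᶜ ⊆ A ∨ Disjoint Γ.complex.Kᶜ A :=
  SegComplex.compl_subset_or_disjoint hA fun x => by
    have := (Γ.noJump_iff_notMem_bd hA x.1 x.2).2 (by simp [h])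
    exact this

end Polygons

end Doublecross

/-! ### Faces, the cycle space and Euler's inequality. -/

namespace Doublecross

open Filter Topology Set

variable {V : Type*} {H : SimpleGraph V}

namespace PlaneDrawing

variable {D : PlaneDrawing H} {F F' : Set Plane}

theorem IsFace.saturated (hF : D.IsFace F) : Saturated D.carrier F := by
  obtain ⟨x, hx, rfl⟩ := hF
  rintro S hS hSc ⟨y, hyS, hyF⟩
  rw [connectedComponentIn_eq hyF]
  exact hSc.subset_connectedComponentIn hyS hS

theorem IsFace.nonempty (hF : D.IsFace F) : F.Nonempty := by
  obtain ⟨x, hx, rfl⟩ := hF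
  exact ⟨x, mem_connectedComponentIn hx⟩

theorem IsFace.subset_compl (hF : D.IsFace F) : F ⊆ D.carrierᶜ := by
  obtain ⟨x, hx, rfl⟩ := hF
  exact connectedComponentIn_subset _ _

theorem IsFace.isPreconnected (hF : D.IsFace F) : IsPreconnected F := by
  obtain ⟨x, hx, rfl⟩ := hF
  exact isPreconnected_connectedComponentIn

theorem IsFace.eq_of_mem (hF : D.IsFace F) (hF' : D.IsFace F') {z : Plane} (hz : z ∈ F)
    (hz' : z ∈ F') : F = F' := by
  obtain ⟨x, hx, rfl⟩ := hF
  obtain ⟨y, hy, rfl⟩ := hF'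
  rw [connectedComponentIn_eq hz, connectedComponentIn_eq hz']

end PlaneDrawing

namespace Polygons

variable {D : PlaneDrawing H} (Γ : Polygons D)

/-- The boundary operator of the oriented graph. -/
noncomputable def boundaryMap [DecidableEq V] [Fintype H.edgeSet] :
    (H.edgeSet → ℝ) →ₗ[ℝ] (V → ℝ) :=
  Fintype.linearCombination ℝ fun e => Pi.single (Γ.hd e) 1 - Pi.single (Γ.tl e) 1

theorem sum_mul_boundaryMap [DecidableEq V] [Fintype V] [Fintype H.edgeSet]
    (f : H.edgeSet → ℝ) (g : V → ℝ) :
    ∑ v, Γ.boundaryMap f v * g v = ∑ e, f e * (g (Γ.hd e) - g (Γ.tl e)) := by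
  simp only [boundaryMap, Fintype.linearCombination_apply, Finset.sum_apply, Pi.smul_apply,
    Pi.sub_apply, smul_eq_mul, Finset.sum_mul]
  rw [Finset.sum_comm]
  refine Finset.sum_congr rfl fun e _ => ?_
  simp only [mul_assoc, sub_mul, ← Finset.mul_sum, Finset.sum_sub_distrib, Pi.single_apply,
    ite_mul, one_mul, zero_mul, Finset.sum_ite_eq', Finset.mem_univ, if_true]

/-- Rank-nullity: the coordinates of a boundary sum to zero, so the boundary map is not surjective
and its rank is at most `|V| - 1`. -/
theorem card_edgeSet_lt [DecidableEq V] [Fintype V] [Nonempty V] [Fintype H.edgeSet] :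
    Fintype.card H.edgeSet + 1 ≤
      Module.finrank ℝ (LinearMap.ker Γ.boundaryMap) + Fintype.card V := by
  have h1 := LinearMap.finrank_range_add_finrank_ker Γ.boundaryMap
  have h2 : Module.finrank ℝ (LinearMap.range Γ.boundaryMap) < Module.finrank ℝ (V → ℝ) := by
    apply Submodule.finrank_lt
    intro htop
    obtain ⟨v⟩ := ‹Nonempty V›
    have : (Pi.single v 1 : V → ℝ) ∈ LinearMap.range Γ.boundaryMap := by rw [htop]; trivial
    obtain ⟨f, hf⟩ := this
    have := Γ.sum_mul_boundaryMap f (fun _ => 1)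
    rw [hf] at this
    simp at this
  rw [Module.finrank_fintype_fun_eq_card] at h1 h2
  omega

variable [Finite V]

/-- The winding number (times `2 π`) of a real weight on the edges. -/
noncomputable def windMap [Fintype H.edgeSet] (z : Plane) : (H.edgeSet → ℝ) →ₗ[ℝ] ℝ where
  toFun f := Γ.complex.wind (fun x => f x.1) z
  map_add' f g := by simp [SegComplex.wind, add_mul, Finset.sum_add_distrib]
  map_smul' c f := by simp [SegComplex.wind, Finset.mul_sum, mul_assoc]

/-- The sum telescopes along each polygon, leaving only the vertices of the graph, where a cycle is
balanced. -/
theorem balanced_of_mem_ker [DecidableEq V] [Fintype H.edgeSet] {f : H.edgeSet → ℝ}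
    (hf : f ∈ LinearMap.ker Γ.boundaryMap) (g : Plane → ℝ) :
    ∑ x : Σ e, Fin (Γ.n e), f x.1 * (g (Γ.complex.Q x) - g (Γ.complex.P x)) = 0 := by
  have : Fintype V := Fintype.ofFinite V
  have h := Γ.sum_mul_boundaryMap f (fun v => g (D.pos v))
  rw [LinearMap.mem_ker.1 hf] at h
  simp only [Pi.zero_apply, zero_mul, Finset.sum_const_zero] at h
  rw [h, Fintype.sum_sigma]
  refine Finset.sum_congr rfl fun e _ => ?_
  rw [← Γ.p_zero, ← Γ.p_last, ← Finset.sum_range_sub (fun k => g (Γ.p e k)), Finset.sum_range,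
    Finset.mul_sum]
  rfl

/-- There are at least as many faces as the dimension of the cycle space, not counting one. -/
theorem exists_faces [DecidableEq V] [Fintype H.edgeSet] {F₀ : Set Plane} (hF₀ : D.IsFace F₀) :
    ∃ 𝓕 : Finset (Set Plane), (∀ F ∈ 𝓕, D.IsFace F ∧ F ≠ F₀) ∧
      Module.finrank ℝ (LinearMap.ker Γ.boundaryMap) ≤ 𝓕.card := by
  set T : Set (Set Plane) := {F | D.IsFace F ∧ F ≠ F₀} with hT
  -- Finiteness of the set of faces need not be proved: with infinitely many, enough of them can
  -- simply be picked.
  by_cases hfin : T.Finite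
  swap
  · obtain ⟨t, ht, hc⟩ := Set.Infinite.exists_subset_card_eq hfin
      (Module.finrank ℝ (LinearMap.ker Γ.boundaryMap))
    exact ⟨t, fun F hF => ht hF, hc.ge⟩
  refine ⟨hfin.toFinset, fun F hF => by simpa [hT] using hF, ?_⟩
  have : Fintype T := hfin.fintype
  have hx : ∀ F : T, ∃ x, x ∈ F.1 := fun F => F.2.1.nonempty
  choose x hx using hx
  obtain ⟨x₀, hx₀⟩ := hF₀.nonempty
  -- A cycle is recorded by its winding on each other face minus that on `F₀`. If all differences
  -- vanish, the winding is constant off the drawing, and then so do all weights.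
  set Φ : LinearMap.ker Γ.boundaryMap →ₗ[ℝ] (T → ℝ) :=
    (LinearMap.pi fun F => Γ.windMap (x F) - Γ.windMap x₀) ∘ₗ Submodule.subtype _ with hΦ
  have hinj : Function.Injective Φ := by
    rw [← LinearMap.ker_eq_bot, LinearMap.ker_eq_bot']
    rintro ⟨f, hf⟩ h0
    have hbal := Γ.balanced_of_mem_ker hf
    have hconst : ∀ z, z ∉ Γ.complex.K →
        Γ.complex.wind (fun x => f x.1) z = Γ.complex.wind (fun x => f x.1) x₀ := by
      intro z hz
      rw [Γ.complex_K] at hz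
      set F := connectedComponentIn D.carrierᶜ z
      have hF : D.IsFace F := ⟨z, hz, rfl⟩
      have hzF : z ∈ F := mem_connectedComponentIn hz
      have hFK : F ⊆ Γ.complex.Kᶜ := by rw [Γ.complex_K]; exact hF.subset_compl
      by_cases hFF : F = F₀
      · exact Γ.complex.wind_eq_of_isPreconnected _ hbal hF.isPreconnected hFK hzF (hFF ▸ hx₀)
      · have h1 := congrFun h0 ⟨F, hF, hFF⟩
        simp only [hΦ, LinearMap.coe_comp, Function.comp_apply, Submodule.subtype_apply,
          LinearMap.pi_apply, LinearMap.sub_apply, Pi.zero_apply, sub_eq_zero] at h1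
        rw [Γ.complex.wind_eq_of_isPreconnected _ hbal hF.isPreconnected hFK hzF (hx ⟨F, hF, hFF⟩)]
        exact h1
    have := Γ.complex.weight_eq_zero_of_wind_const _ _ hconst
    ext e
    exact this (Γ.fst e)
  have := LinearMap.finrank_le_finrank_of_injective hinj
  rw [Module.finrank_fintype_fun_eq_card] at this
  rwa [Set.Finite.card_toFinset]

theorem saturated_of_isFace {F : Set Plane} (hF : D.IsFace F) : Saturated Γ.complex.K F := by
  rw [Γ.complex_K]; exact hF.saturated

/-- The face `F` lies along the edge `e` on the side given by the sign of `σ`. -/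
def FaceAt (F : Set Plane) (e : H.edgeSet) (σ : ℝ) : Prop :=
  Γ.complex.Germ F (Γ.fst e) σ
    (midpoint ℝ (Γ.complex.P (Γ.fst e)) (Γ.complex.Q (Γ.fst e)))

variable {Γ}

theorem FaceAt.unique {F F' : Set Plane} (hF : D.IsFace F) (hF' : D.IsFace F') {e : H.edgeSet}
    {σ : ℝ} (hσ : σ ≠ 0) (h : Γ.FaceAt F e σ) (h' : Γ.FaceAt F' e σ) : F = F' := by
  obtain ⟨z, h1, h2⟩ := SegComplex.Germ.exists_mem hσ (Γ.complex.midpoint_mem _) h h'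
  exact hF.eq_of_mem hF' h1 h2

theorem mem_bd_iff {F : Set Plane} {e : H.edgeSet} :
    e ∈ Γ.bd F ↔ ¬ (Γ.FaceAt F e 1 ↔ Γ.FaceAt F e (-1)) := Iff.rfl

theorem faceAt_of_mem_closure {F : Set Plane} (hF : D.IsFace F) {e : H.edgeSet}
    (h : midpoint ℝ (Γ.complex.P (Γ.fst e)) (Γ.complex.Q (Γ.fst e)) ∈ closure F) :
    Γ.FaceAt F e 1 ∨ Γ.FaceAt F e (-1) := by
  have hm := Γ.complex.midpoint_mem (Γ.fst e)
  rw [mem_closure_iff_frequently] at h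
  have h2 := h.and_eventually (SegComplex.eventually_mem_K_iff hm)
  have h3 : ∃ᶠ z in 𝓝 (midpoint ℝ (Γ.complex.P (Γ.fst e)) (Γ.complex.Q (Γ.fst e))),
      (0 < 1 * side (Γ.complex.P (Γ.fst e)) (Γ.complex.Q (Γ.fst e)) z ∧ z ∈ F) ∨
      (0 < -1 * side (Γ.complex.P (Γ.fst e)) (Γ.complex.Q (Γ.fst e)) z ∧ z ∈ F) := by
    refine h2.mono fun z hz => ?_
    have hzK : z ∉ Γ.complex.K := by rw [Γ.complex_K]; exact hF.subset_compl hz.1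
    rcases lt_or_gt_of_ne (fun h => hzK (hz.2.2 h)) with h | h
    · exact Or.inr ⟨by linarith, hz.1⟩
    · exact Or.inl ⟨by linarith, hz.1⟩
  rcases frequently_or_distrib.1 h3 with h | h
  · exact Or.inl (SegComplex.germ_of_frequently (Γ.saturated_of_isFace hF) hm h)
  · exact Or.inr (SegComplex.germ_of_frequently (Γ.saturated_of_isFace hF) hm h)

theorem bd_nonempty {F F₀ : Set Plane} (hF : D.IsFace F) (hF₀ : D.IsFace F₀) (hne : F ≠ F₀) :
    (Γ.bd F).Nonempty := by
  by_contra hemp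
  rw [not_nonempty_iff_eq_empty] at hemp
  obtain ⟨x, hx⟩ := hF.nonempty
  obtain ⟨x₀, hx₀⟩ := hF₀.nonempty
  have := Γ.compl_subset_or_disjoint_of_bd_eq_empty (Γ.saturated_of_isFace hF) hemp
  rw [Γ.complex_K] at this
  rcases this with h | h
  · exact hne (hF.eq_of_mem hF₀ (h (hF₀.subset_compl hx₀)) hx₀)
  · exact disjoint_left.1 h (hF.subset_compl hx) hx

/-- Faces other than `F₀` are determined by the edges along which they lie on one side only. -/
theorem bd_injective {F F' F₀ : Set Plane} (hF : D.IsFace F) (hF' : D.IsFace F')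
    (hF₀ : D.IsFace F₀) (hne : F ≠ F₀) (hne' : F' ≠ F₀) (h : Γ.bd F = Γ.bd F') : F = F' := by
  by_contra hFF
  have hsat : Saturated Γ.complex.K (F ∪ F') := by
    rintro S hS hSc ⟨y, hyS, hy | hy⟩
    · exact (Γ.saturated_of_isFace hF S hS hSc ⟨y, hyS, hy⟩).trans subset_union_left
    · exact (Γ.saturated_of_isFace hF' S hS hSc ⟨y, hyS, hy⟩).trans subset_union_right
  have hgerm : ∀ (e : H.edgeSet) (σ : ℝ), σ ≠ 0 →
      (Γ.FaceAt (F ∪ F') e σ ↔ Γ.FaceAt F e σ ∨ Γ.FaceAt F' e σ) := by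
    intro e σ hσ
    have hm := Γ.complex.midpoint_mem (Γ.fst e)
    constructor
    · intro hu
      by_contra! hcon
      have h1 := (SegComplex.germ_or_germ_compl (Γ.saturated_of_isFace hF) hm).resolve_left hcon.1
      have h2 := (SegComplex.germ_or_germ_compl (Γ.saturated_of_isFace hF') hm).resolve_left hcon.2
      have h3 : Γ.FaceAt (F ∪ F')ᶜ e σ := by
        filter_upwards [h1, h2] with z hz hz' hs
        simpa using ⟨hz hs, hz' hs⟩
      exact SegComplex.Germ.not_germ_compl hσ hm hu h3
    · rintro (h | h) <;> refine Eventually.mono h fun z hz hs => ?_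
      · exact Or.inl (hz hs)
      · exact Or.inr (hz hs)
  -- Each side of an edge belongs to at most one of `F` and `F'`. At a common boundary edge they
  -- therefore occupy opposite sides, and at any other edge each has both sides or none; either way
  -- the union does not jump.
  have hemp : Γ.bd (F ∪ F') = ∅ := by
    rw [eq_empty_iff_forall_notMem]
    intro e
    rw [mem_bd_iff, not_not, hgerm e 1 one_ne_zero, hgerm e (-1) (by norm_num)]
    have he : e ∈ Γ.bd F ↔ e ∈ Γ.bd F' := by rw [h]
    rw [mem_bd_iff, mem_bd_iff] at he
    have u1 : ¬ (Γ.FaceAt F e 1 ∧ Γ.FaceAt F' e 1) := fun hh =>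
      hFF (FaceAt.unique hF hF' one_ne_zero hh.1 hh.2)
    have u2 : ¬ (Γ.FaceAt F e (-1) ∧ Γ.FaceAt F' e (-1)) := fun hh =>
      hFF (FaceAt.unique hF hF' (by norm_num) hh.1 hh.2)
    tauto
  obtain ⟨x, hx⟩ := hF.nonempty
  obtain ⟨x₀, hx₀⟩ := hF₀.nonempty
  have := Γ.compl_subset_or_disjoint_of_bd_eq_empty hsat hemp
  rw [Γ.complex_K] at this
  rcases this with h | h
  · rcases h (hF₀.subset_compl hx₀) with h' | h'
    · exact hne (hF.eq_of_mem hF₀ h' hx₀)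
    · exact hne' (hF'.eq_of_mem hF₀ h' hx₀)
  · exact disjoint_left.1 h (hF.subset_compl hx) (Or.inl hx)

end Polygons

/-- Euler's inequality for a drawing, in terms of boundaries of the faces other than `F₀`: there
are at least `|E| - |V| + 1` of them, and every edge lies on at most two boundaries, at most one if
it is on the frontier of `F₀`. -/
theorem PlaneDrawing.exists_boundaries [Fintype V] [Nonempty V] (D : PlaneDrawing H)
    {F₀ : Set Plane} (hF₀ : D.IsFace F₀) (T : Finset (Sym2 V))
    (hT : ∀ e ∈ T, e ∈ H.edgeSet ∧ D.arc e ⊆ frontier F₀) :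
    ∃ 𝓑 : Finset (Finset (Sym2 V)),
      (∀ B ∈ 𝓑, (B : Set (Sym2 V)) ⊆ H.edgeSet ∧ B.Nonempty ∧
        ∀ e ∈ B, ∀ v ∈ e, ∃ e' ∈ B, e' ≠ e ∧ v ∈ e') ∧
      H.edgeSet.ncard + 1 ≤ 𝓑.card + Fintype.card V ∧
      ∑ B ∈ 𝓑, B.card + T.card ≤ 2 * H.edgeSet.ncard := by
  classical
  obtain ⟨Γ⟩ := exists_polygons D
  have : Fintype H.edgeSet := Fintype.ofFinite _
  obtain ⟨𝓕, h𝓕, hcard⟩ := Γ.exists_faces hF₀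
  have hdim := Γ.card_edgeSet_lt
  set β : Set Plane → Finset (Sym2 V) := fun F => (Γ.bd F).toFinset.map (Function.Embedding.subtype _)
    with hβ
  have hmem : ∀ F (e : H.edgeSet), e.1 ∈ β F ↔ e ∈ Γ.bd F := by
    intro F e
    simp [hβ]
  have hsub : ∀ F, ∀ e ∈ β F, e ∈ H.edgeSet := by
    intro F e he
    simp only [hβ, Finset.mem_map, Function.Embedding.subtype_apply] at he
    obtain ⟨a, -, rfl⟩ := he
    exact a.2
  have hinj : Set.InjOn β 𝓕 := by
    intro F hF F' hF' h
    refine Polygons.bd_injective (Γ := Γ) (h𝓕 F hF).1 (h𝓕 F' hF').1 hF₀ (h𝓕 F hF).2 (h𝓕 F' hF').2 ?_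
    ext e
    rw [← hmem, ← hmem, h]
  rw [← Nat.card_coe_set_eq, Nat.card_eq_fintype_card]
  refine ⟨𝓕.image β, ?_, ?_, ?_⟩
  · intro B hB
    obtain ⟨F, hF, rfl⟩ := Finset.mem_image.1 hB
    refine ⟨fun e he => hsub F e he, ?_, ?_⟩
    · obtain ⟨e, he⟩ := Polygons.bd_nonempty (Γ := Γ) (h𝓕 F hF).1 hF₀ (h𝓕 F hF).2
      exact ⟨e.1, (hmem F e).2 he⟩
    · intro e he v hv
      obtain ⟨e', h1, h2, h3⟩ := Γ.exists_mem_bd_of_mem_bd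
        (Γ.saturated_of_isFace (h𝓕 F hF).1) (e := ⟨e, hsub F e he⟩) ((hmem F _).1 he) hv
      exact ⟨e'.1, (hmem F e').2 h1, fun h => h2 (Subtype.ext h), h3⟩
  · rw [Finset.card_image_of_injOn hinj]
    omega
  · rw [Finset.sum_image hinj]
    have hT' : T.card = ∑ e : H.edgeSet, if e.1 ∈ T then 1 else 0 := by
      rw [Finset.sum_boole, Nat.cast_id]
      refine (Finset.card_bij (fun e _ => e.1) ?_ ?_ ?_).symm
      · intro e he; simpa using he
      · intro e _ e' _ h; exact Subtype.ext h
      · intro e he; exact ⟨⟨e, (hT e he).1⟩, by simpa using he, rfl⟩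
    have hB : ∑ F ∈ 𝓕, (β F).card = ∑ e : H.edgeSet, (𝓕.filter fun F => e ∈ Γ.bd F).card := by
      have : ∀ F, (β F).card = ∑ e : H.edgeSet, if e ∈ Γ.bd F then 1 else 0 := by
        intro F
        rw [hβ, Finset.card_map, Finset.sum_boole, Nat.cast_id]
        congr 1; ext e; simp
      simp only [this, Finset.card_filter]
      rw [Finset.sum_comm]
    rw [hT', hB, ← Finset.sum_add_distrib, mul_comm, ← smul_eq_mul, ← Finset.card_univ]
    -- Count edge by edge: each side of `e` belongs to at most one face, and if `e ∈ T` then one of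
    -- the sides is already taken by `F₀`.
    refine Finset.sum_le_card_nsmul _ _ _ fun e _ => ?_
    have hu1 : ∀ σ : ℝ, σ ≠ 0 → (𝓕.filter fun F => Γ.FaceAt F e σ).card ≤ 1 := by
      intro σ hσ
      rw [Finset.card_le_one]
      intro F hF F' hF'
      rw [Finset.mem_filter] at hF hF'
      exact Polygons.FaceAt.unique (h𝓕 F hF.1).1 (h𝓕 F' hF'.1).1 hσ hF.2 hF'.2
    have hle : (𝓕.filter fun F => e ∈ Γ.bd F).card ≤
        (𝓕.filter fun F => Γ.FaceAt F e 1).card + (𝓕.filter fun F => Γ.FaceAt F e (-1)).card := by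
      refine (Finset.card_le_card ?_).trans (Finset.card_union_le _ _)
      intro F hF
      rw [Finset.mem_filter] at hF
      rw [Finset.mem_union, Finset.mem_filter, Finset.mem_filter]
      have := Polygons.mem_bd_iff.1 hF.2
      have := hF.1
      tauto
    have a1 := hu1 1 one_ne_zero
    have a2 := hu1 (-1) (by norm_num)
    split_ifs with heT
    · have hcl : midpoint ℝ (Γ.complex.P (Γ.fst e)) (Γ.complex.Q (Γ.fst e)) ∈ closure F₀ :=
        frontier_subset_closure ((hT e.1 heT).2 (Γ.segment_subset_arc e (Γ.n_pos e)
          (openSegment_subset_segment _ _ _ (Γ.complex.midpoint_mem (Γ.fst e)))))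
      have hz : ∀ σ : ℝ, σ ≠ 0 → Γ.FaceAt F₀ e σ → (𝓕.filter fun F => Γ.FaceAt F e σ).card = 0 := by
        intro σ hσ h
        rw [Finset.card_eq_zero, Finset.filter_eq_empty_iff]
        intro F hF h'
        exact (h𝓕 F hF).2 (Polygons.FaceAt.unique (h𝓕 F hF).1 hF₀ hσ h' h)
      rcases Polygons.faceAt_of_mem_closure hF₀ hcl with h | h
      · have := hz 1 one_ne_zero h; omega
      · have := hz (-1) (by norm_num) h; omega
    · omega

end Doublecross

/-! ### Circuits in a graph of girth at least five. -/

namespace Doublecross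

open Set

variable {V : Type*} {G H : SimpleGraph V}

/-- In a forest, the last vertex of a path has no neighbour on the path except the penultimate
vertex. Without leaves every path could thus be extended, eventually beyond `|V|` vertices. -/
theorem not_isAcyclic_of_leafless [Finite V] {a b : V} (hab : H.Adj a b)
    (hleaf : ∀ v w, H.Adj v w → ∃ x, x ≠ v ∧ H.Adj w x) : ¬ H.IsAcyclic := by
  intro hac
  have : Fintype V := Fintype.ofFinite V
  have key : ∀ n, ∃ (u v : V) (p : H.Walk u v), p.IsPath ∧ p.length = n + 1 := by
    intro n
    induction n with
    | zero =>
      exact ⟨a, b, SimpleGraph.Walk.cons hab .nil, by simpa using hab.ne, by simp⟩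
    | succ n ih =>
      obtain ⟨u, v, p, hp, hl⟩ := ih
      have hnil : ¬ p.Nil := fun h => by
        have := SimpleGraph.Walk.length_eq_zero_iff.2 h; omega
      obtain ⟨x, hx, hvx⟩ := hleaf _ _ (p.adj_penultimate hnil)
      refine ⟨u, x, p.concat hvx, hp.concat (fun hmem => hx ?_) hvx, by simp [hl]⟩
      exact hac.eq_penultimate_of_adj_end hp hvx hmem
  obtain ⟨u, v, p, hp, hl⟩ := key (Fintype.card V)
  have := hp.length_lt
  omega

theorem five_le_length (hgirth : 5 ≤ G.egirth) {a : V} {c : G.Walk a a} (hc : c.IsCycle) :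
    5 ≤ c.length := by
  have := SimpleGraph.le_egirth.1 hgirth a c hc
  exact_mod_cast this

/-- A nonempty set of edges without vertices of degree one has at least as many elements as the
girth, here five, and with equality it is the edge set of a shortest circuit. -/
theorem five_le_card_of_leafless [Finite V] (hgirth : 5 ≤ G.egirth) {B : Finset (Sym2 V)}
    (hB : (B : Set (Sym2 V)) ⊆ G.edgeSet) (hne : B.Nonempty)
    (hleaf : ∀ e ∈ B, ∀ v ∈ e, ∃ e' ∈ B, e' ≠ e ∧ v ∈ e') :
    5 ≤ B.card ∧ (B.card = 5 → ∃ P : G.Subgraph, IsPentagon G P ∧ P.edgeSet = B) := by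
  classical
  set G' := SimpleGraph.fromEdgeSet (B : Set (Sym2 V)) with hG'
  have hle : G' ≤ G := by
    rw [hG', SimpleGraph.fromEdgeSet_le]
    exact fun e he => hB he.1
  have hadj : ∀ v w, G'.Adj v w ↔ s(v, w) ∈ B := by
    intro v w
    rw [hG', SimpleGraph.fromEdgeSet_adj]
    refine ⟨fun h => h.1, fun h => ⟨h, ?_⟩⟩
    exact G.ne_of_adj (hB h)
  have hnac : ¬ G'.IsAcyclic := by
    obtain ⟨e, he⟩ := hne
    induction e with | _ a b
    refine not_isAcyclic_of_leafless ((hadj a b).2 he) fun v w hvw => ?_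
    obtain ⟨e', h1, h2, h3⟩ := hleaf _ ((hadj v w).1 hvw) w (Sym2.mem_mk_right v w)
    obtain ⟨x, rfl⟩ := h3
    refine ⟨x, ?_, (hadj w x).2 h1⟩
    rintro rfl
    exact h2 Sym2.eq_swap
  obtain ⟨a, c, hc⟩ : ∃ (a : V) (c : G'.Walk a a), c.IsCycle := by
    by_contra! hcon
    exact hnac fun a c => hcon a c
  have hc' : (c.mapLe hle).IsCycle := hc.mapLe hle
  have h5 := five_le_length hgirth hc'
  have hlen : (c.mapLe hle).length = c.length := by simp
  have hcard : c.edges.toFinset.card = c.length := by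
    rw [List.toFinset_card_of_nodup hc.edges_nodup, c.length_edges]
  have hsub : c.edges.toFinset ⊆ B := by
    intro e he
    have := c.edges_subset_edgeSet (List.mem_toFinset.1 he)
    rw [hG', SimpleGraph.edgeSet_fromEdgeSet] at this
    exact this.1
  have hle' := Finset.card_le_card hsub
  refine ⟨by omega, fun hB5 => ⟨(c.mapLe hle).toSubgraph, ⟨a, c.mapLe hle, hc', by omega, rfl⟩, ?_⟩⟩
  -- The circuit has at least five edges, all in `B`; if `B` has only five, they are all used.
  have heq := Finset.eq_of_subset_of_card_le hsub (by omega)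
  ext e
  rw [SimpleGraph.Walk.mem_edges_toSubgraph, SimpleGraph.Walk.edges_mapLe_eq_edges, ← heq]
  simp

theorem exists_walk_of_forall_adj {x : ℕ → V} (n : ℕ) : ∀ i j, i + n = j →
    (∀ k, i ≤ k → k < j → H.Adj (x k) (x (k + 1))) →
    ∃ p : H.Walk (x i) (x j), p.length = n ∧ p.support = (List.range' i (n + 1)).map x := by
  induction n with
  | zero =>
    rintro i j rfl -
    exact ⟨.nil, rfl, rfl⟩
  | succ n ih =>
    intro i j hij h
    obtain ⟨p, hl, hs⟩ := ih (i + 1) j (by omega) fun k hk => h k (by omega)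
    refine ⟨.cons (h i le_rfl (by omega)) p, by simp [hl], ?_⟩
    rw [SimpleGraph.Walk.support_cons, hs, List.range'_succ (n := n + 1), List.map_cons]

/-- A circuit using the edges in `T`, and otherwise only edges of `H`, has length at least five;
and if its length is five then it is a pentagon. -/
theorem length_of_cycle (hgirth : 5 ≤ G.egirth) {a : V} {c : G.Walk a a}
    (hc : c.IsCycle) (T : Set (Sym2 V)) (hT : ∀ e, e ∉ H.edgeSet → (e ∈ c.edges ↔ e ∈ T)) :
    5 ≤ c.length ∧ (c.length = 5 → ∃ P : G.Subgraph, IsPentagon G P ∧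
      ∀ e, e ∉ H.edgeSet → (e ∈ P.edgeSet ↔ e ∈ T)) := by
  refine ⟨five_le_length hgirth hc, fun h5 => ⟨c.toSubgraph, ⟨a, c, hc, h5, rfl⟩, fun e he => ?_⟩⟩
  rw [SimpleGraph.Walk.mem_edges_toSubgraph, hT e he]

/-- The circuit formed by a subpath of a circuit and a chord. -/
theorem chord {x : ℕ → V} {ℓ : ℕ} (hHG : H ≤ G) (hgirth : 5 ≤ G.egirth)
    (hinj : Set.InjOn x {k | k < ℓ}) (hadj : ∀ k < ℓ, H.Adj (x k) (x (k + 1)))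
    {i k : ℕ} (hik : i < k) (hk : k < ℓ) (h : G.Adj (x i) (x k))
    (hH : s(x i, x k) ∉ H.edgeSet) :
    5 ≤ k - i + 1 ∧ (k - i + 1 = 5 → ∃ P : G.Subgraph, IsPentagon G P ∧
      ∀ e, e ∉ H.edgeSet → (e ∈ P.edgeSet ↔ e ∈ ({s(x i, x k)} : Set (Sym2 V)))) := by
  obtain ⟨p, hl, hs⟩ := exists_walk_of_forall_adj (H := H) (x := x) (k - i) i k (by omega)
    fun m _ hm => hadj m (by omega)
  have hp : p.IsPath := by
    rw [SimpleGraph.Walk.isPath_def, hs]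
    refine List.Nodup.map_on ?_ List.nodup_range'
    intro a ha b hb
    rw [List.mem_range'_1] at ha hb
    exact hinj (by simp only [mem_ofPred_eq]; omega) (by simp only [mem_ofPred_eq]; omega)
  have hpe : ∀ e ∈ p.edges, e ∈ H.edgeSet := fun e he => p.edges_subset_edgeSet he
  have hc : (SimpleGraph.Walk.cons h.symm (p.mapLe hHG)).IsCycle := by
    rw [SimpleGraph.Walk.cons_isCycle_iff]
    refine ⟨hp.mapLe hHG, ?_⟩
    rw [SimpleGraph.Walk.edges_mapLe_eq_edges, Sym2.eq_swap]
    exact fun hmem => hH (hpe _ hmem)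
  have := length_of_cycle (H := H) hgirth hc {s(x i, x k)} (fun e he => by
    rw [SimpleGraph.Walk.edges_cons, SimpleGraph.Walk.edges_mapLe_eq_edges, List.mem_cons,
      mem_singleton_iff, Sym2.eq_swap (a := x k)]
    exact or_iff_left fun hmem => he (hpe _ hmem))
  simpa [hl] using this

/-- The circuit formed by two disjoint subpaths of a circuit and two crossing chords. -/
theorem crossing_chords {x : ℕ → V} {ℓ : ℕ} (hHG : H ≤ G) (hgirth : 5 ≤ G.egirth)
    (hinj : Set.InjOn x {k | k < ℓ}) (hadj : ∀ k < ℓ, H.Adj (x k) (x (k + 1)))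
    {i j k l : ℕ} (hij : i < j) (hjk : j < k) (hkl : k < l) (hl : l < ℓ)
    (h₁ : G.Adj (x i) (x k)) (h₂ : G.Adj (x j) (x l))
    (hH₁ : s(x i, x k) ∉ H.edgeSet) :
    5 ≤ (j - i) + (l - k) + 2 ∧ ((j - i) + (l - k) + 2 = 5 → ∃ P : G.Subgraph, IsPentagon G P ∧
      ∀ e, e ∉ H.edgeSet →
        (e ∈ P.edgeSet ↔ e ∈ ({s(x i, x k), s(x j, x l)} : Set (Sym2 V)))) := by
  obtain ⟨p, hpl, hps⟩ := exists_walk_of_forall_adj (H := H) (x := x) (j - i) i j (by omega)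
    fun m _ hm => hadj m (by omega)
  obtain ⟨q, hql, hqs⟩ := exists_walk_of_forall_adj (H := H) (x := x) (l - k) k l (by omega)
    fun m _ hm => hadj m (by omega)
  have hpe : ∀ e ∈ p.edges, e ∈ H.edgeSet := fun e he => p.edges_subset_edgeSet he
  have hqe : ∀ e ∈ q.edges, e ∈ H.edgeSet := fun e he => q.edges_subset_edgeSet he
  have hx : ∀ a b, a < ℓ → b < ℓ → x a = x b → a = b := fun a b ha hb h => hinj ha hb h
  set r : G.Walk (x i) (x k) := (p.mapLe hHG).append (.cons h₂ (q.mapLe hHG).reverse) with hr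
  have hrp : r.IsPath := by
    rw [SimpleGraph.Walk.isPath_def, hr, SimpleGraph.Walk.support_append,
      SimpleGraph.Walk.support_cons, List.tail_cons, SimpleGraph.Walk.support_reverse,
      SimpleGraph.Walk.support_mapLe_eq_support, SimpleGraph.Walk.support_mapLe_eq_support, hps, hqs,
      List.nodup_append]
    refine ⟨List.Nodup.map_on ?_ List.nodup_range',
      List.nodup_reverse.2 (List.Nodup.map_on ?_ List.nodup_range'), ?_⟩
    · intro a ha b hb
      rw [List.mem_range'_1] at ha hb
      exact hx a b (by omega) (by omega)
    · intro a ha b hb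
      rw [List.mem_range'_1] at ha hb
      exact hx a b (by omega) (by omega)
    · intro a ha b hb hab
      rw [List.mem_reverse] at hb
      obtain ⟨a', ha', rfl⟩ := List.mem_map.1 ha
      obtain ⟨b', hb', rfl⟩ := List.mem_map.1 hb
      rw [List.mem_range'_1] at ha' hb'
      have := hx a' b' (by omega) (by omega) hab
      omega
  have hre : ∀ e, e ∈ r.edges ↔ e ∈ p.edges ∨ e = s(x j, x l) ∨ e ∈ q.edges := by
    intro e
    simp [hr, SimpleGraph.Walk.edges_append]
  have hne : s(x k, x i) ≠ s(x j, x l) := by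
    intro h
    rw [Sym2.eq_iff] at h
    rcases h with ⟨h, -⟩ | ⟨h, -⟩
    · have := hx _ _ (by omega) (by omega) h; omega
    · have := hx _ _ (by omega) (by omega) h; omega
  have hc : (SimpleGraph.Walk.cons h₁.symm r).IsCycle := by
    rw [SimpleGraph.Walk.cons_isCycle_iff]
    refine ⟨hrp, ?_⟩
    rw [hre]
    rintro (h | h | h)
    · exact hH₁ (Sym2.eq_swap ▸ hpe _ h)
    · exact hne h
    · exact hH₁ (Sym2.eq_swap ▸ hqe _ h)
  have hlen : (SimpleGraph.Walk.cons h₁.symm r).length = (j - i) + (l - k) + 2 := by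
    simp [hr, hpl, hql]; omega
  have := length_of_cycle (H := H) hgirth hc {s(x i, x k), s(x j, x l)} (fun e he => by
    rw [SimpleGraph.Walk.edges_cons, List.mem_cons, hre, mem_insert_iff,
      mem_singleton_iff, Sym2.eq_swap (a := x k)]
    have h1 := fun h => he (hpe e h)
    have h2 := fun h => he (hqe e h)
    tauto)
  rwa [hlen] at this

end Doublecross

/-! ### Counting the pentagons. -/

namespace Doublecross

open Set

variable {V : Type*} {G H : SimpleGraph V}

/-- The pentagons among the face boundaries: at least `|C| - 10` of them. -/
theorem exists_pentagons_of_drawing [Fintype V] (hHG : H ≤ G) (hgirth : 5 ≤ G.egirth)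
    (hcard : 2 * H.edgeSet.ncard + 8 = 3 * Fintype.card V) (D : PlaneDrawing H) {a : V}
    (C : H.Walk a a) (hC : C.IsCycle) (hD : D.OuterFaceBoundedBy C) :
    ∃ 𝓟 : Finset G.Subgraph, (∀ P ∈ 𝓟, IsPentagon G P ∧ P.edgeSet ⊆ H.edgeSet) ∧
      C.length ≤ 𝓟.card + 10 := by
  classical
  have : Nonempty V := ⟨a⟩
  obtain ⟨F₀, hF₀, -, hfr⟩ := hD
  obtain ⟨𝓑, h𝓑, hcard1, hsum⟩ := D.exists_boundaries hF₀ C.edges.toFinset (by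
    intro e he
    rw [List.mem_toFinset] at he
    refine ⟨C.edges_subset_edgeSet he, ?_⟩
    rw [hfr]
    exact subset_biUnion_of_mem (u := fun e => D.arc e) (show e ∈ {e | e ∈ C.edges} from he))
  rw [List.toFinset_card_of_nodup hC.edges_nodup, C.length_edges] at hsum
  have hB := fun B (hB : B ∈ 𝓑) => five_le_card_of_leafless hgirth
    ((h𝓑 B hB).1.trans (SimpleGraph.edgeSet_subset_edgeSet.2 hHG)) (h𝓑 B hB).2.1 (h𝓑 B hB).2.2
  set 𝓑₅ := 𝓑.filter fun B => B.card = 5 with h𝓑₅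
  have hP : ∀ B : 𝓑₅, ∃ P : G.Subgraph, IsPentagon G P ∧ P.edgeSet = B.1 := fun B =>
    (hB B.1 (Finset.mem_filter.1 B.2).1).2 (Finset.mem_filter.1 B.2).2
  choose P hP1 hP2 using hP
  have hPinj : Function.Injective P := fun B B' h => by
    apply Subtype.ext
    rw [← Finset.coe_inj, ← hP2, ← hP2, h]
  refine ⟨Finset.univ.map ⟨P, hPinj⟩, ?_, ?_⟩
  · intro Q hQ
    simp only [Finset.mem_map, Finset.mem_univ, true_and, Function.Embedding.coeFn_mk] at hQ
    obtain ⟨B, rfl⟩ := hQ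
    exact ⟨hP1 B, by rw [hP2]; exact (h𝓑 B.1 (Finset.mem_filter.1 B.2).1).1⟩
  · rw [Finset.card_map, Finset.card_univ, Fintype.card_coe]
    -- Every boundary has at least six edges, except that each pentagonal one falls short by one.
    -- Together with Euler's inequality and `2E + 8 = 3V`, this leaves the constant 10.
    have h6 : 6 * 𝓑.card ≤ ∑ B ∈ 𝓑, B.card + 𝓑₅.card := by
      rw [h𝓑₅, Finset.card_filter, ← Finset.sum_add_distrib, mul_comm, ← smul_eq_mul]
      refine Finset.card_nsmul_le_sum _ _ _ fun B hB' => ?_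
      have := (hB B hB').1
      split_ifs <;> omega
    omega

theorem exists_indices {l L : List V} (h : l.Sublist L) :
    ∃ i : ℕ → ℕ, (∀ m n, m < n → n < l.length → i m < i n) ∧
      ∀ m (hm : m < l.length), L[i m]? = some l[m] := by
  rw [List.sublist_iff_exists_orderEmbedding_getElem?_eq] at h
  obtain ⟨f, hf⟩ := h
  exact ⟨f, fun m n hmn _ => f.lt_iff_lt.2 hmn, fun m hm => by rw [← hf m, List.getElem?_eq_getElem hm]⟩

theorem two_mul_ncard_deleteEdges_add [Fintype V] [DecidableRel G.Adj]
    (hcubic : G.IsRegularOfDegree 3) (T : Finset (Sym2 V)) (hT : (T : Set (Sym2 V)) ⊆ G.edgeSet) :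
    2 * (G.deleteEdges T).edgeSet.ncard + 2 * T.card = 3 * Fintype.card V := by
  classical
  have h1 := G.sum_degrees_eq_twice_card_edges
  simp only [hcubic.degree_eq, Finset.sum_const, Finset.card_univ, smul_eq_mul] at h1
  have h2 : (G.deleteEdges T).edgeSet.ncard + T.card = G.edgeFinset.card := by
    rw [SimpleGraph.edgeSet_deleteEdges, ← Set.ncard_coe_finset T, Set.ncard_sdiff_add_ncard_of_subset hT,
      ← SimpleGraph.coe_edgeFinset, Set.ncard_coe_finset]
  omega

theorem crossing_edges_injective {u v : Fin 4 → V}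
    (h : [u 0, u 1, v 0, v 1, u 2, u 3, v 2, v 3].Nodup) :
    Function.Injective fun i => s(u i, v i) := by
  simp only [List.nodup_cons, List.mem_cons, List.not_mem_nil, or_false, not_or] at h
  intro a b hab
  simp only [Sym2.eq_iff] at hab
  fin_cases a <;> fin_cases b <;> simp at hab ⊢ <;> grind

/-- A crossing pair of chords with ends at positions `a < b < c < d` of a circuit gives at least
`7 - (d - a)` pentagons. -/
theorem crossing_pair_count {a b c d p q r : ℕ} (hab : a < b) (hbc : b < c) (hcd : c < d)
    (h₁ : 5 ≤ c - a + 1) (h₂ : 5 ≤ d - b + 1) (h₃ : 5 ≤ (b - a) + (d - c) + 2)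
    (hp : c - a + 1 = 5 → 1 ≤ p) (hq : d - b + 1 = 5 → 1 ≤ q)
    (hr : (b - a) + (d - c) + 2 = 5 → 1 ≤ r) : a + 7 ≤ d + p + q + r := by
  -- The three length bounds add up to `2(d - a) ≥ 4 + 4 + 3`, so `d - a ≥ 6`. If `d - a = 6`, the
  -- total slack is one, so some bound is tight and yields a pentagon.
  by_cases h : c - a + 1 = 5
  · have := hp h
    by_cases h' : d - b + 1 = 5
    · have := hq h'
      omega
    · omega
  · omega

/-- If `H` is drawn with outer circuit `C`, and the edges `e i = u i v i` cross in two pairs along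
`C`, then there are at least six pentagons. -/
theorem six_le_ncard_pentagons [Fintype V] (hHG : H ≤ G) (hgirth : 5 ≤ G.egirth)
    (hcard : 2 * H.edgeSet.ncard + 8 = 3 * Fintype.card V) {u v : Fin 4 → V} {e : Fin 4 → Sym2 V}
    (he : ∀ i, e i = s(u i, v i)) (heinj : Function.Injective e)
    (huv : ∀ i, G.Adj (u i) (v i)) (heH : ∀ i, e i ∉ H.edgeSet)
    (hnodup : [u 0, u 1, v 0, v 1, u 2, u 3, v 2, v 3].Nodup)
    (D : PlaneDrawing H) (C : H.Walk (u 0) (u 0)) (hC : C.IsCycle) (hD : D.OuterFaceBoundedBy C)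
    (hsub : [u 0, u 1, v 0, v 1, u 2, u 3, v 2, v 3].Sublist C.support) :
    6 ≤ Set.ncard {P : G.Subgraph | IsPentagon G P} := by
  classical
  obtain ⟨i, hmono, hget⟩ := exists_indices hsub
  -- positions on the circuit
  have hlt : ∀ m (hm : m < 8), i m ≤ C.length := fun m hm => by
    have h := hget m hm
    have := (List.getElem?_eq_some_iff.1 h).1
    rw [C.length_support] at this
    omega
  have hpos : ∀ m (hm : m < 8), C.getVert (i m) =
      [u 0, u 1, v 0, v 1, u 2, u 3, v 2, v 3][m] := fun m hm => by
    have h := hget m hm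
    rw [← SimpleGraph.Walk.getVert_eq_support_getElem? _ (hlt m hm)] at h
    exact Option.some.inj h
  have hx0 : C.getVert (i 0) = u 0 := hpos 0 (by norm_num)
  have hx1 : C.getVert (i 1) = u 1 := hpos 1 (by norm_num)
  have hx2 : C.getVert (i 2) = v 0 := hpos 2 (by norm_num)
  have hx3 : C.getVert (i 3) = v 1 := hpos 3 (by norm_num)
  have hx4 : C.getVert (i 4) = u 2 := hpos 4 (by norm_num)
  have hx5 : C.getVert (i 5) = u 3 := hpos 5 (by norm_num)
  have hx6 : C.getVert (i 6) = v 2 := hpos 6 (by norm_num)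
  have hx7 : C.getVert (i 7) = v 3 := hpos 7 (by norm_num)
  have hstep : ∀ m, m + 1 < 8 → i m < i (m + 1) := fun m hm => hmono m (m + 1) (by omega) hm
  have s0 : i 0 < i 1 := hstep 0 (by norm_num)
  have s1 : i 1 < i 2 := hstep 1 (by norm_num)
  have s2 : i 2 < i 3 := hstep 2 (by norm_num)
  have s3 : i 3 < i 4 := hstep 3 (by norm_num)
  have s4 : i 4 < i 5 := hstep 4 (by norm_num)
  have s5 : i 5 < i 6 := hstep 5 (by norm_num)
  have s6 : i 6 < i 7 := hstep 6 (by norm_num)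
  have s7 : i 7 < C.length := by
    -- The support of `C` repeats `u 0` at index `C.length`; since `v 3 ≠ u 0`, that index is
    -- excluded.
    refine lt_of_le_of_ne (hlt 7 (by norm_num)) fun h => ?_
    rw [h, C.getVert_length] at hx7
    simp [hx7] at hnodup
  have hinj : Set.InjOn C.getVert {k | k < C.length} := by
    refine hC.getVert_injOn'.mono fun k hk => ?_
    have : k < C.length := hk
    show k ≤ C.length - 1
    omega
  have hadj : ∀ k < C.length, H.Adj (C.getVert k) (C.getVert (k + 1)) := fun k hk =>
    C.adj_getVert_succ hk
  -- pentagons with prescribed intersection with the four crossing edges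
  set pent : Finset G.Subgraph := (Set.toFinite {P : G.Subgraph | IsPentagon G P}).toFinset
    with hpent
  set sig : G.Subgraph → Finset (Fin 4) := fun P => Finset.univ.filter fun j => e j ∈ P.edgeSet
    with hsig
  set N : Finset (Fin 4) → ℕ := fun t => (pent.filter fun P => sig P = t).card with hN
  have hNpos : ∀ (t : Finset (Fin 4)) (T : Set (Sym2 V)), (∀ j, e j ∈ T ↔ j ∈ t) →
      (∃ P : G.Subgraph, IsPentagon G P ∧ ∀ e, e ∉ H.edgeSet → (e ∈ P.edgeSet ↔ e ∈ T)) →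
      1 ≤ N t := by
    rintro t T hT ⟨P, hP, hPT⟩
    refine Finset.card_pos.2 ⟨P, Finset.mem_filter.2 ⟨by simpa [hpent] using hP, ?_⟩⟩
    ext j
    rw [hsig, Finset.mem_filter, hPT _ (heH j), hT]
    simp
  have hT1 : ∀ a j : Fin 4, e j ∈ ({e a} : Set (Sym2 V)) ↔ j ∈ ({a} : Finset (Fin 4)) := by
    intro a j
    rw [Set.mem_singleton_iff, heinj.eq_iff, Finset.mem_singleton]
  have hT2 : ∀ a b j : Fin 4, e j ∈ ({e a, e b} : Set (Sym2 V)) ↔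
      j ∈ ({a, b} : Finset (Fin 4)) := by
    intro a b j
    rw [Set.mem_insert_iff, Set.mem_singleton_iff, heinj.eq_iff, heinj.eq_iff, Finset.mem_insert,
      Finset.mem_singleton]
  -- the circuits through crossing edges
  have c0 := chord hHG hgirth hinj hadj (i := i 0) (k := i 2) (by omega) (by omega)
    (by rw [hx0, hx2]; exact huv 0) (by rw [hx0, hx2]; rw [← he]; exact heH 0)
  have c1 := chord hHG hgirth hinj hadj (i := i 1) (k := i 3) (by omega) (by omega)
    (by rw [hx1, hx3]; exact huv 1) (by rw [hx1, hx3]; rw [← he]; exact heH 1)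
  have c2 := chord hHG hgirth hinj hadj (i := i 4) (k := i 6) (by omega) (by omega)
    (by rw [hx4, hx6]; exact huv 2) (by rw [hx4, hx6]; rw [← he]; exact heH 2)
  have c3 := chord hHG hgirth hinj hadj (i := i 5) (k := i 7) (by omega) (by omega)
    (by rw [hx5, hx7]; exact huv 3) (by rw [hx5, hx7]; rw [← he]; exact heH 3)
  have c01 := crossing_chords hHG hgirth hinj hadj (i := i 0) (j := i 1) (k := i 2) (l := i 3)
    s0 s1 s2 (by omega) (by rw [hx0, hx2]; exact huv 0) (by rw [hx1, hx3]; exact huv 1)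
    (by rw [hx0, hx2]; rw [← he]; exact heH 0)
  have c23 := crossing_chords hHG hgirth hinj hadj (i := i 4) (j := i 5) (k := i 6) (l := i 7)
    s4 s5 s6 s7 (by rw [hx4, hx6]; exact huv 2) (by rw [hx5, hx7]; exact huv 3)
    (by rw [hx4, hx6]; rw [← he]; exact heH 2)
  rw [hx0, hx2, ← he] at c0
  rw [hx1, hx3, ← he] at c1
  rw [hx4, hx6, ← he] at c2
  rw [hx5, hx7, ← he] at c3
  rw [hx0, hx2, hx1, hx3, ← he, ← he] at c01
  rw [hx4, hx6, hx5, hx7, ← he, ← he] at c23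
  have n0 := fun h => hNpos {0} {e 0} (hT1 0) (c0.2 h)
  have n1 := fun h => hNpos {1} {e 1} (hT1 1) (c1.2 h)
  have n2 := fun h => hNpos {2} {e 2} (hT1 2) (c2.2 h)
  have n3 := fun h => hNpos {3} {e 3} (hT1 3) (c3.2 h)
  have n01 := fun h => hNpos {0, 1} {e 0, e 1} (hT2 0 1) (c01.2 h)
  have n23 := fun h => hNpos {2, 3} {e 2, e 3} (hT2 2 3) (c23.2 h)
  have hleft := crossing_pair_count s0 s1 s2 c0.1 c1.1 c01.1 n0 n1 n01
  have hright := crossing_pair_count s4 s5 s6 c2.1 c3.1 c23.1 n2 n3 n23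
  clear c0 c1 c2 c3 c01 c23 n0 n1 n2 n3 n01 n23
  -- the pentagons among the faces
  obtain ⟨𝓟, h𝓟, hlen⟩ := exists_pentagons_of_drawing hHG hgirth hcard D C hC hD
  have nEmpty : 𝓟.card ≤ N ∅ := by
    refine Finset.card_le_card fun P hP => Finset.mem_filter.2 ⟨?_, ?_⟩
    · simpa [hpent] using (h𝓟 P hP).1
    · rw [hsig, Finset.filter_eq_empty_iff]
      exact fun j _ hj => heH j ((h𝓟 P hP).2 hj)
  -- Pentagons with different values of `sig` are different, so these seven classes are disjoint.
  have htotal : N ∅ + N {0} + N {1} + N {0, 1} + N {2} + N {3} + N {2, 3} ≤ pent.card := by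
    have h1 : pent.card = ∑ t : Finset (Fin 4), N t :=
      Finset.card_eq_sum_card_fiberwise fun P _ => Finset.mem_coe.2 (Finset.mem_univ (sig P))
    have h2 := Finset.sum_le_sum_of_subset (f := N) (Finset.subset_univ
      ({∅, {0}, {1}, {0, 1}, {2}, {3}, {2, 3}} : Finset (Finset (Fin 4))))
    rw [h1]
    refine le_trans (le_of_eq ?_) h2
    rw [Finset.sum_insert (by decide), Finset.sum_insert (by decide), Finset.sum_insert (by decide),
      Finset.sum_insert (by decide), Finset.sum_insert (by decide), Finset.sum_insert (by decide),
      Finset.sum_singleton]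
    ring
  rw [Set.ncard_eq_toFinset_card _ (Set.toFinite _)]
  change 6 ≤ pent.card
  -- Since `i 3 < i 4` and `i 7 < |C|`, one has `|C| ≥ (i 3 - i 0) + (i 7 - i 4) + 2`. By `hleft`
  -- and `hright` this is at least 16 minus the pentagons through deleted edges, while `|C| ≤ N ∅ +
  -- 10`.
  omega

end Doublecross

theorem mainTheorem4 {V : Type*} [Fintype V] (G : SimpleGraph V) [DecidableRel G.Adj]
    (hcubic : G.IsRegularOfDegree 3) (hgirth : 5 ≤ G.egirth)
    (hG : Doublecross.IsDoublecross G) :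
    6 ≤ Set.ncard {P : G.Subgraph | Doublecross.IsPentagon G P} := by
  obtain ⟨u, v, huv, hnodup, D, C, hC, hD, hsub⟩ := hG
  have heinj := Doublecross.crossing_edges_injective hnodup
  refine Doublecross.six_le_ncard_pentagons (G.deleteEdges_le _) hgirth ?_ (fun _ => rfl) heinj huv
    (fun i => ?_) hnodup D C hC hD hsub
  · have := Doublecross.two_mul_ncard_deleteEdges_add hcubic
      (Finset.univ.map ⟨fun i => s(u i, v i), heinj⟩) (by
        intro f hf
        simp only [Finset.coe_map, Function.Embedding.coeFn_mk, Finset.coe_univ,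
          Set.image_univ] at hf
        obtain ⟨j, rfl⟩ := hf
        exact huv j)
    simpa using this
  · rw [SimpleGraph.edgeSet_deleteEdges]
    exact fun h => h.2 ⟨i, rfl⟩
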